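/- Let $A$ be a commutative $\mathbb{Q}$-algebra (of functions of the KP times $t=(t_1\equiv x,t_2,t_3,\dots)$) with pairwise commuting derivations $\partial_n=\partial/\partial t_n$, $n\ge 1$; write $\partial=\partial_1=\partial_x$. Let $r\ge 1$ and let $$L=D^r+\sum_{j=0}^{r-2}v_jD^j+\sum_{i\ge1}u_iD^{-i}$$ be a pseudo-differential operator over $A$ (with $D^n f=\sum_{j\ge0}\binom nj(\partial^jf)D^{n-j}$ for $n\in\mathbb Z$), let $L^{1/r}=D+\cdots$ be its $r$-th root, and suppose that the KP Lax equations $\partial L/\partial t_n=[(L^{n/r})_+,L]$ hold for all $n\ge1$, where $(\cdot)_+$ denotes the differential part. Let $\Phi\in A$ be an eigenfunction, $\partial_n\Phi=(L^{n/r})_+(\Phi)$, and let $\Psi\in A$ be an adjoint eigenfunction, $\partial_n\Psi=-((L^*)^{n/r})_+(\Psi)$, for all $n\ge1$, where $*$ is the formal adjoint. Let $S(t)=S(\Phi(t),\Psi(t))\in A$ be a squared eigenfunction potential of $\Phi,\Psi$, i.e. $$\partial_nS=\mathrm{Res}\bigl(D^{-1}\,\Psi\,(L^{n/r})_+\,\Phi\,D^{-1}\bigr)\qquad(n\ge1),$$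 where $\mathrm{Res}$ is the coefficient of $D^{-1}$. For $f\in A$ let $$f(t\mp[\lambda^{-1}])=\exp\Bigl(\mp\sum_{l\ge1}\tfrac1l\lambda^{-l}\tfrac{\partial}{\partial t_l}\Bigr)f\in A[[\lambda^{-1}]],\qquad[\lambda^{-1}]=(\lambda^{-1},\tfrac12\lambda^{-2},\tfrac13\lambda^{-3},\dots).$$ Then, as identities of formal power series in $\lambda^{-1}$, $$S(t-[\lambda^{-1}])-S(t)=-\lambda^{-1}\,\Phi(t)\,\Psi(t-[\lambda^{-1}]),$$ $$S(t+[\lambda^{-1}])-S(t)=\lambda^{-1}\,\Phi(t+[\lambda^{-1}])\,\Psi(t).$$ Moreover, let the Schur polynomials $p_s$ be defined by $\exp\bigl(\sum_{l\ge1}\lambda^lt_l\bigr)=\sum_{s\ge0}\lambda^sp_s(t_1,t_2,\dots)$, and let $[\partial]=(\partial/\partial t_1,\tfrac12\partial/\partial t_2,\tfrac13\partial/\partial t_3,\dots)$. Then for all $s\ge1$ $$p_s(-[\partial])S=-\Phi\;p_{s-1}(-[\partial])\Psi,\qquad p_s([\partial])S=\Psi\;p_{s-1}([\partial])\Phi .$$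 -/

import Mathlib

namespace KP

/-- A pseudo-differential operator `∑_{k ≤ N} a_k D^k` over `A`, given by its coefficients `a_k`
(written to the left of the powers of `D`). -/
@[ext]
structure PDO (A : Type*) [Zero A] where
  coeff : ℤ → A
  bounded : ∃ N : ℤ, ∀ k : ℤ, N < k → coeff k = 0

namespace PDO

variable {A : Type*} [CommRing A] [Algebra ℚ A]

/-- The operator `a D^n`. -/
def monomial (n : ℤ) (a : A) : PDO A where
  coeff k := if k = n then a else 0
  bounded := ⟨n, fun k hk => if_neg (by omega)⟩

/-- The product of pseudo-differential operators. The generalized Leibniz rule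
`D^i f = ∑_m (i choose m) (d^m f) D^(i-m)` for all integers `i` says that the coefficient of `D^k`
in `(∑ p_i D^i) (∑ q_j D^j)` is the sum (with finitely many nonzero terms) of
`(i choose m) p_i d^m (q_j)` over all `i`, `j`, `m ≥ 0` with `i + j - m = k`. -/
noncomputable def mul (d : Derivation ℚ A A) (P Q : PDO A) : PDO A where
  coeff k := ∑ᶠ x : ℤ × ℕ,
    (Ring.choose x.1 x.2 : ℤ) • (P.coeff x.1 * (d^[x.2]) (Q.coeff (k - x.1 + x.2)))
  bounded := by
    obtain ⟨N, hN⟩ := P.bounded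
    obtain ⟨M, hM⟩ := Q.bounded
    refine ⟨N + M, fun k hk => ?_⟩
    rw [← finsum_zero (α := ℤ × ℕ)]
    refine finsum_congr fun x => ?_
    by_cases hx : N < x.1
    · rw [hN _ hx, zero_mul, smul_zero]
    · have h0 : (d^[x.2]) (0 : A) = 0 := Function.iterate_fixed (map_zero d) _
      rw [hM _ (by omega), h0, mul_zero, smul_zero]

/-- Natural powers of a pseudo-differential operator. -/
noncomputable def pow (d : Derivation ℚ A A) (P : PDO A) : ℕ → PDO A
  | 0 => monomial 0 1
  | n + 1 => mul d (pow d P n) P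

/-- The purely differential part `P_+`. -/
def plus (P : PDO A) : PDO A where
  coeff k := if 0 ≤ k then P.coeff k else 0
  bounded := by
    obtain ⟨N, hN⟩ := P.bounded
    exact ⟨N, fun k hk => by rw [hN k hk, ite_self]⟩

/-- The formal adjoint: `(a D^j)^* = (-D)^j a = (-1)^j ∑_m (j choose m) (d^m a) D^(j-m)`. -/
noncomputable def adjoint (d : Derivation ℚ A A) (P : PDO A) : PDO A where
  coeff k := ∑ᶠ m : ℕ,
    (((k + m).negOnePow : ℤ) * Ring.choose (k + m) m) • (d^[m]) (P.coeff (k + m))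
  bounded := by
    obtain ⟨N, hN⟩ := P.bounded
    refine ⟨N, fun k hk => ?_⟩
    rw [← finsum_zero (α := ℕ)]
    refine finsum_congr fun m => ?_
    have h0 : (d^[m]) (0 : A) = 0 := Function.iterate_fixed (map_zero d) _
    rw [hN _ (by omega), h0, smul_zero]

/-- The residue: the coefficient of `D^(-1)`. -/
def res (P : PDO A) : A := P.coeff (-1)

/-- `P_+ (f)`: the action on a function `f` of the differential part of `P`. -/
noncomputable def plusApply (d : Derivation ℚ A A) (P : PDO A) (f : A) : A :=
  ∑ᶠ j : ℕ, P.plus.coeff j * (d^[j]) f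

/-- `L = D^r + ∑_{j=0}^{r-2} v_j D^j + ∑_{i ≥ 1} u_i D^(-i)`. -/
def IsLaxForm (r : ℕ) (L : PDO A) : Prop :=
  L.coeff r = 1 ∧ L.coeff (r - 1) = 0 ∧ ∀ k : ℤ, (r : ℤ) < k → L.coeff k = 0

/-- `Q = L^(1/r)`: the operator `Q = D + (lower order)` with `Q^r = L`. -/
def IsRoot (d : Derivation ℚ A A) (r : ℕ) (L Q : PDO A) : Prop :=
  Q.coeff 1 = 1 ∧ (∀ k : ℤ, 1 < k → Q.coeff k = 0) ∧ pow d Q r = L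

end PDO

section Hierarchy

variable {A : Type*} [CommRing A] [Algebra ℚ A]

/-- The Lax equations `∂L/∂t_n = [(L^(n/r))_+, L]`, `n ≥ 1`, where `Q = L^(1/r)`, `∂ n = ∂/∂t_n`
and `∂ 1 = ∂/∂x`. -/
def LaxEquations (pd : ℕ+ → Derivation ℚ A A) (L Q : PDO A) : Prop :=
  ∀ (n : ℕ+) (k : ℤ), pd n (L.coeff k) =
    (PDO.mul (pd 1) (PDO.pow (pd 1) Q n).plus L).coeff k -
      (PDO.mul (pd 1) L (PDO.pow (pd 1) Q n).plus).coeff k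

/-- `∂Φ/∂t_n = (L^(n/r))_+ (Φ)` for all `n ≥ 1`, where `Q = L^(1/r)`. -/
def IsEigenfunction (pd : ℕ+ → Derivation ℚ A A) (Q : PDO A) (Φ : A) : Prop :=
  ∀ n : ℕ+, pd n Φ = PDO.plusApply (pd 1) (PDO.pow (pd 1) Q n) Φ

/-- `∂Ψ/∂t_n = -((L^*)^(n/r))_+ (Ψ)` for all `n ≥ 1`, where `Q = L^(1/r)`. -/
def IsAdjointEigenfunction (pd : ℕ+ → Derivation ℚ A A) (Q : PDO A) (Ψ : A) : Prop :=
  ∀ n : ℕ+, pd n Ψ = -PDO.plusApply (pd 1) (PDO.pow (pd 1) (PDO.adjoint (pd 1) Q) n) Ψ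

/-- `S` is a squared eigenfunction potential of `Φ` and `Ψ`:
`∂S/∂t_n = Res (D^(-1) Ψ (L^(n/r))_+ Φ D^(-1))` for all `n ≥ 1`, where `Q = L^(1/r)`. -/
def IsSEP (pd : ℕ+ → Derivation ℚ A A) (Q : PDO A) (Φ Ψ S : A) : Prop :=
  ∀ n : ℕ+, pd n S = PDO.res
    (PDO.mul (pd 1) (PDO.mul (pd 1) (PDO.mul (pd 1) (PDO.mul (pd 1)
      (PDO.monomial (-1) 1) (PDO.monomial 0 Ψ)) (PDO.pow (pd 1) Q n).plus)
      (PDO.monomial 0 Φ)) (PDO.monomial (-1) 1))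

end Hierarchy

section Shift

/-- `exp θ = ∑_k θ^k / k!` for a power series `θ` without constant term
(then `θ^k` does not contribute to the coefficient of index `n < k`). -/
noncomputable def expSeries {E : Type*} [Ring E] [Algebra ℚ E] (θ : PowerSeries E) :
    PowerSeries E :=
  PowerSeries.mk fun n =>
    ∑ k ∈ Finset.range (n + 1), (1 / (k.factorial : ℚ)) • PowerSeries.coeff n (θ ^ k)

/-- `∑_{l ≥ 1} x_l λ^l` as a formal power series in `λ`. -/
noncomputable def timeSeries {E : Type*} [Ring E] (x : ℕ+ → E) : PowerSeries E :=
  PowerSeries.mk fun l => if h : 0 < l then x ⟨l, h⟩ else 0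

/-- The Schur polynomials: `exp (∑_{l ≥ 1} λ^l t_l) = ∑_n λ^n p_n(t_1, t_2, …)`. -/
noncomputable def schurPoly (n : ℕ) : MvPolynomial ℕ+ ℚ :=
  PowerSeries.coeff n (expSeries (timeSeries fun l => (MvPolynomial.X l : MvPolynomial ℕ+ ℚ)))

open scoped IsMulCommutative in
/-- The value `p(x_1, x_2, …)` of a polynomial at pairwise commuting elements of an algebra. -/
noncomputable def evalCommuting {E : Type*} [Ring E] [Algebra ℚ E] (x : ℕ+ → E)
    (hx : ∀ a ∈ Set.range x, ∀ b ∈ Set.range x, a * b = b * a) : MvPolynomial ℕ+ ℚ →ₐ[ℚ] E :=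
  haveI := Algebra.isMulCommutative_adjoin ℚ hx
  (Algebra.adjoin ℚ (Set.range x)).val.comp
    (MvPolynomial.aeval fun l => ⟨x l, Algebra.subset_adjoin ⟨l, rfl⟩⟩)

open scoped IsMulCommutative in
theorem evalCommuting_X {E : Type*} [Ring E] [Algebra ℚ E] (x : ℕ+ → E)
    (hx : ∀ a ∈ Set.range x, ∀ b ∈ Set.range x, a * b = b * a) (l : ℕ+) :
    evalCommuting x hx (MvPolynomial.X l) = x l := by
  have := Algebra.isMulCommutative_adjoin ℚ hx
  simp [evalCommuting]

variable {A : Type*} [CommRing A] [Algebra ℚ A]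

/-- The sequence of operators `c [∂] = (c ∂/∂t_1, (c/2) ∂/∂t_2, (c/3) ∂/∂t_3, …)`. -/
noncomputable def bracketD (pd : ℕ+ → Derivation ℚ A A) (c : ℚ) (l : ℕ+) : Module.End ℚ A :=
  (c / ((l : ℕ) : ℚ)) • (pd l : A →ₗ[ℚ] A)

theorem bracketD_comm {pd : ℕ+ → Derivation ℚ A A}
    (hpd : ∀ (m n : ℕ+) (f : A), pd m (pd n f) = pd n (pd m f)) (c : ℚ) :
    ∀ a ∈ Set.range (bracketD pd c), ∀ b ∈ Set.range (bracketD pd c), a * b = b * a := by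
  rintro _ ⟨m, rfl⟩ _ ⟨n, rfl⟩
  ext f
  simp only [bracketD, Module.End.mul_apply, LinearMap.smul_apply, Derivation.coeFn_coe,
    map_smul, hpd m n f]
  rw [smul_comm]

/-- The differential operator `p(c [∂]) = p(c ∂/∂t_1, (c/2) ∂/∂t_2, (c/3) ∂/∂t_3, …)`. -/
noncomputable def polyD (pd : ℕ+ → Derivation ℚ A A)
    (hpd : ∀ (m n : ℕ+) (f : A), pd m (pd n f) = pd n (pd m f)) (c : ℚ)
    (p : MvPolynomial ℕ+ ℚ) : Module.End ℚ A :=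
  evalCommuting (bracketD pd c) (bracketD_comm hpd c) p

/-- The Taylor expansion of `f (t + c [λ⁻¹])`, `[λ⁻¹] = (λ⁻¹, λ⁻²/2, λ⁻³/3, …)`, as a formal power
series in `λ⁻¹`, that is `exp (c ∑_{l ≥ 1} λ^(-l)/l ∂/∂t_l) f`.
The variable `PowerSeries.X` stands for `λ⁻¹`. -/
noncomputable def miwaShift (pd : ℕ+ → Derivation ℚ A A) (c : ℚ) (f : A) : PowerSeries A :=
  PowerSeries.mk fun n => PowerSeries.coeff n (expSeries (timeSeries (bracketD pd c))) f

theorem coeff_timeSeries_leibniz (pd : ℕ+ → Derivation ℚ A A) (c : ℚ) (n : ℕ) (f g : A) :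
    PowerSeries.coeff n (timeSeries (bracketD pd c)) (f * g) =
      f * PowerSeries.coeff n (timeSeries (bracketD pd c)) g +
      PowerSeries.coeff n (timeSeries (bracketD pd c)) f * g := by
  simp only [timeSeries, PowerSeries.coeff_mk]
  split_ifs
  · simp [bracketD, mul_comm]
  · simp

theorem coeff_pow_timeSeries_leibniz (pd : ℕ+ → Derivation ℚ A A) (c : ℚ) (k n : ℕ) (f g : A) :
    PowerSeries.coeff n (timeSeries (bracketD pd c) ^ k) (f * g) =
    ∑ ij ∈ Finset.HasAntidiagonal.antidiagonal k, ∑ ab ∈ Finset.HasAntidiagonal.antidiagonal n, (k.choose ij.1 : A) *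
      (PowerSeries.coeff ab.1 (timeSeries (bracketD pd c) ^ ij.1) f *
        PowerSeries.coeff ab.2 (timeSeries (bracketD pd c) ^ ij.2) g) := by
  set θ := timeSeries (bracketD pd c) with hθ
  let F : ℕ → A → PowerSeries A := fun k f => PowerSeries.mk fun n => PowerSeries.coeff n (θ ^ k) f
  let T : PowerSeries A → PowerSeries A := fun H => PowerSeries.mk fun n =>
    ∑ ij ∈ Finset.HasAntidiagonal.antidiagonal n, PowerSeries.coeff ij.1 θ (PowerSeries.coeff ij.2 H)
  have hF : ∀ k f, F (k + 1) f = T (F k f) := by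
    intro k f
    ext n
    simp [F, T, pow_succ', PowerSeries.coeff_mul, LinearMap.sum_apply]
  have hTadd : ∀ G H, T (G + H) = T G + T H := by
    intro G H; ext n; simp [T, Finset.sum_add_distrib]
  have hTmul : ∀ G H, T (G * H) = G * T H + T G * H := by
    intro G H
    ext n
    simp only [T, PowerSeries.coeff_mk, map_add, PowerSeries.coeff_mul, map_sum,
      coeff_timeSeries_leibniz, hθ, Finset.sum_add_distrib, Finset.mul_sum, Finset.sum_mul]
    congr 1
    · simp only [Finset.sum_sigma']
      apply Finset.sum_nbij' (fun x => ⟨(x.2.1, x.1.1 + x.2.2), (x.1.1, x.2.2)⟩)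
        (fun x => ⟨(x.2.1, x.1.1 + x.2.2), (x.1.1, x.2.2)⟩) <;>
      · simp only [Finset.mem_sigma, Finset.HasAntidiagonal.mem_antidiagonal, Prod.forall, Sigma.forall]
        grind
    · rw [Finset.sum_sigma', Finset.sum_sigma']
      apply Finset.sum_nbij' (fun x => ⟨(x.1.1 + x.2.1, x.2.2), (x.1.1, x.2.1)⟩)
        (fun x => ⟨(x.2.1, x.2.2 + x.1.2), (x.2.2, x.1.2)⟩) <;>
      · simp only [Finset.mem_sigma, Finset.HasAntidiagonal.mem_antidiagonal, Prod.forall, Sigma.forall]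
        grind
  have key : ∀ k, F k (f * g) =
      ∑ ij ∈ Finset.HasAntidiagonal.antidiagonal k, (k.choose ij.1 : PowerSeries A) * (F ij.1 f * F ij.2 g) := by
    let T' : Derivation ℤ (PowerSeries A) (PowerSeries A) :=
      Derivation.mk' (AddMonoidHom.mk' T hTadd).toIntLinearMap (by
        intro a b; exact (hTmul a b).trans (by rw [mul_comm (T a)]; rfl))
    have hT' : ∀ G, T G = T' G := fun G => rfl
    intro k
    induction k with
    | zero =>
      ext n
      simp only [F, pow_zero, Finset.Nat.antidiagonal_zero, Finset.sum_singleton, Nat.choose_self,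
        Nat.cast_one, one_mul, PowerSeries.coeff_mk, PowerSeries.coeff_one]
      have e : ∀ h : A, (PowerSeries.mk fun n => (if n = 0 then (1 : Module.End ℚ A) else 0) h)
          = PowerSeries.C h := by
        intro h; ext n; simp [PowerSeries.coeff_C]; split_ifs <;> simp
      simp [e, ← map_mul, PowerSeries.coeff_C]; split_ifs <;> simp
    | succ k ih =>
      rw [hF, ih, hT', map_sum, Finset.sum_antidiagonal_choose_succ_mul
        (fun i j => F i f * F j g), ← Finset.sum_add_distrib]
      refine Finset.sum_congr rfl fun ij hij => ?_
      rw [Finset.HasAntidiagonal.mem_antidiagonal] at hij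
      have hc : (k.choose ij.2 : PowerSeries A) = k.choose ij.1 := by
        rw [← hij, Nat.add_comm ij.1, Nat.choose_symm_add.symm]
      rw [hc, ← mul_add, hF, hF, ← hTmul, hT', ← nsmul_eq_mul, map_nsmul, nsmul_eq_mul]
  have h := congrArg (PowerSeries.coeff n) (key k)
  simp only [F, PowerSeries.coeff_mk, map_sum, ← nsmul_eq_mul, map_nsmul, PowerSeries.coeff_mul]
    at h
  simp only [h, Finset.smul_sum, nsmul_eq_mul]

theorem coeff_pow_timeSeries_of_lt (pd : ℕ+ → Derivation ℚ A A) (c : ℚ) (k n : ℕ) (h : n < k) :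
    PowerSeries.coeff n (timeSeries (bracketD pd c) ^ k) = 0 := by
  induction k generalizing n with
  | zero => omega
  | succ k ih =>
    rw [pow_succ, PowerSeries.coeff_mul]
    refine Finset.sum_eq_zero fun ij hij => ?_
    rw [Finset.HasAntidiagonal.mem_antidiagonal] at hij
    by_cases h2 : ij.2 = 0
    · simp [timeSeries, h2]
    · rw [ih _ (by omega), zero_mul]

theorem coeff_miwaShift (pd : ℕ+ → Derivation ℚ A A) (c : ℚ) (f : A) (n N : ℕ) (h : n ≤ N) :
    PowerSeries.coeff n (miwaShift pd c f) = ∑ k ∈ Finset.range (N + 1),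
      (1 / (k.factorial : ℚ)) • PowerSeries.coeff n (timeSeries (bracketD pd c) ^ k) f := by
  simp only [miwaShift, expSeries, PowerSeries.coeff_mk, LinearMap.sum_apply, LinearMap.smul_apply]
  refine Finset.sum_subset (by simpa using h) fun k _ hk => ?_
  rw [coeff_pow_timeSeries_of_lt _ _ _ _ (by simpa using hk)]
  simp

/-- The shift is multiplicative; together with its value on a coordinate function `t_m`, given by
`miwaShift_coordinate`, this says that it is the substitution `t_m ↦ t_m + c λ^(-m)/m`. -/
theorem miwaShift_mul (pd : ℕ+ → Derivation ℚ A A) (c : ℚ) (f g : A) :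
    miwaShift pd c (f * g) = miwaShift pd c f * miwaShift pd c g := by
  ext n
  rw [PowerSeries.coeff_mul, coeff_miwaShift _ _ _ _ _ (le_refl n)]
  simp only [coeff_pow_timeSeries_leibniz, Finset.smul_sum]
  have hR : ∀ ab ∈ Finset.HasAntidiagonal.antidiagonal n,
      PowerSeries.coeff ab.1 (miwaShift pd c f) * PowerSeries.coeff ab.2 (miwaShift pd c g) =
      ∑ k ∈ Finset.range (n + 1), ∑ ij ∈ Finset.HasAntidiagonal.antidiagonal k,
        (1 / (k.factorial : ℚ)) • ((k.choose ij.1 : A) *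
      (PowerSeries.coeff ab.1 (timeSeries (bracketD pd c) ^ ij.1) f *
        PowerSeries.coeff ab.2 (timeSeries (bracketD pd c) ^ ij.2) g)) := by
    intro ab hab
    rw [Finset.HasAntidiagonal.mem_antidiagonal] at hab
    rw [coeff_miwaShift _ _ _ _ n (by omega), coeff_miwaShift _ _ _ _ n (by omega),
      Finset.sum_mul_sum, ← Finset.sum_product', Finset.sum_sigma']
    symm
    refine Finset.sum_of_injOn (fun x => x.2) ?_ ?_ ?_ ?_
    · rintro ⟨k, i, j⟩ hx ⟨k', i', j'⟩ hx' hxx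
      simp at hx hx' hxx ⊢
      omega
    · rintro ⟨k, i, j⟩ hx
      simp at hx ⊢
      omega
    · rintro ⟨i, j⟩ hx hx'
      simp at hx hx' ⊢
      by_cases h1 : ab.1 < i
      · simp [coeff_pow_timeSeries_of_lt _ _ _ _ h1]
      · rw [coeff_pow_timeSeries_of_lt _ _ _ ab.2 (show ab.2 < j by omega)]
        simp
    · rintro ⟨k, i, j⟩ hx
      simp at hx
      obtain ⟨hk, rfl⟩ := hx
      simp only [smul_mul_smul_comm, ← nsmul_eq_mul]
      rw [← Nat.cast_smul_eq_nsmul ℚ, smul_smul]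
      congr 1
      rw [Nat.cast_add_choose]
      field_simp
  rw [Finset.sum_congr rfl hR, Finset.sum_comm]
  refine Finset.sum_congr rfl fun k _ => ?_
  rw [Finset.sum_comm]

theorem miwaShift_coordinate (pd : ℕ+ → Derivation ℚ A A) (c : ℚ) (m : ℕ+) (t : A)
    (ht : ∀ l, pd l t = if l = m then 1 else 0) :
    miwaShift pd c t =
      PowerSeries.C t + PowerSeries.C (algebraMap ℚ A (c / (m : ℕ))) * PowerSeries.X ^ (m : ℕ) := by
  have h1 : ∀ n, PowerSeries.coeff n (timeSeries (bracketD pd c)) t =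
      if n = (m : ℕ) then algebraMap ℚ A (c / (m : ℕ)) else 0 := by
    intro n
    simp only [timeSeries, PowerSeries.coeff_mk]
    split_ifs with h h' h'
    · subst h'
      have e : (⟨(m : ℕ), h⟩ : ℕ+) = m := rfl
      simp only [bracketD, e, LinearMap.smul_apply, Derivation.coeFn_coe, ht, if_true,
        Algebra.algebraMap_eq_smul_one]
    · have : (⟨n, h⟩ : ℕ+) ≠ m := fun e => h' (by rw [← e]; rfl)
      have e : pd ⟨n, h⟩ t = 0 := (ht _).trans (if_neg this)
      simp only [bracketD, LinearMap.smul_apply, Derivation.coeFn_coe]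
      rw [e, smul_zero]
    · exact absurd m.pos (by omega)
    · simp
  have hconst : ∀ n q, PowerSeries.coeff n (timeSeries (bracketD pd c)) (algebraMap ℚ A q) = 0 := by
    intro n q
    simp only [timeSeries, PowerSeries.coeff_mk]
    split_ifs <;> simp [bracketD]
  have h2 : ∀ k n, (PowerSeries.coeff n (timeSeries (bracketD pd c) ^ (k + 2)) : Module.End ℚ A) t = 0 := by
    intro k n
    rw [pow_add, pow_two, ← mul_assoc, PowerSeries.coeff_mul, LinearMap.sum_apply]
    refine Finset.sum_eq_zero fun x _ => ?_
    rw [Module.End.mul_apply, h1]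
    split_ifs
    · rw [PowerSeries.coeff_mul, LinearMap.sum_apply]
      exact Finset.sum_eq_zero fun y _ => by rw [Module.End.mul_apply, hconst, map_zero]
    · rw [map_zero]
  ext n
  rw [coeff_miwaShift _ _ _ n (n + 1) (by omega), Finset.sum_range_succ', Finset.sum_range_succ']
  have hm := m.ne_zero
  simp only [add_assoc, Nat.reduceAdd, h2, smul_zero, Finset.sum_const_zero, pow_zero, zero_add,
    pow_one, h1, map_add, PowerSeries.coeff_C_mul, PowerSeries.coeff_one, PowerSeries.coeff_C, PowerSeries.coeff_X_pow]
  rw [add_comm]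
  congr 1
  · split_ifs <;> simp
  · split_ifs <;> simp

end Shift

end KP

/-! Write ε for λ⁻¹ and consider N = ε d/dε + ∑ ε^l ∂_l on power series in ε (`flow`). It has two
decisive properties. It kills every shift f(t-[ε]), because ε d/dε of exp(-∑ ε^l ∂_l / l) produces
exactly -∑ ε^l ∂_l (`flow_miwaShift`). It is also triangular with diagonal entries n, so over ℚ a
series killed by N with zero constant term vanishes (`eq_zero_of_flow_eq_zero`). The first identity
thus reduces to computing N S.

Let Q = L^(1/r) and B = ∑ ε^n (Q^n)_+, which packages all the flows at once. The Lax equations for L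
= Q^r pass to Q (`der_eq_commutator_of_pow`). There is a unique-looking normal form V(1-εQ) = G with
V = 1 + O(D⁻¹) and G = 1 + c - εD for a function c (`dressSeries_mul`). Comparing differential parts
gives G B = 1 + ερ with ρ = ∑ ε^n Res Q^n (`miwaOp_mul_geomPlus`), and differentiating V(1-εQ) = G
gives N c = c - ερ (`flow_dressFun`).

Put η = Ψ(t-[ε]). From these two formulas and N η = 0, the series Z = G*η - Ψ satisfies N Z = Z -
Res(D⁻¹ Z B) with Z(0) = 0, which forces Z = 0 (`miwaOpAdj_miwaShift`). Substituting Ψ = G*η in the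
definition of S and using D⁻¹(G*η) = D⁻¹ηG + εη gives N S = εη(Φ + N Φ) (`flow_C_potential`). Hence
N kills S(t-[ε]) - S + εΦη, whose constant term is zero, and the first identity follows.

Applying the multiplicative inverse shift to it gives the second identity; reading off the
coefficient of ε^s gives the two Schur polynomial identities (`polyD_schurPoly`). -/

/-! ### Antidiagonal sums, higher Leibniz rule and binomial identities. -/

open Finset in
theorem Finset.sum_antidiagonal_assoc {M : Type*} [AddCommMonoid M] (n : ℕ) (f : ℕ → ℕ → ℕ → M) :
    ∑ x ∈ antidiagonal n, ∑ y ∈ antidiagonal x.1, f y.1 y.2 x.2 =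
      ∑ x ∈ antidiagonal n, ∑ y ∈ antidiagonal x.2, f x.1 y.1 y.2 := by
  rw [Finset.sum_sigma', Finset.sum_sigma']
  apply Finset.sum_nbij' (fun x => ⟨(x.2.1, x.2.2 + x.1.2), (x.2.2, x.1.2)⟩)
    (fun x => ⟨(x.1.1 + x.2.1, x.2.2), (x.1.1, x.2.1)⟩) <;>
  · simp only [Finset.mem_sigma, HasAntidiagonal.mem_antidiagonal, Prod.forall, Sigma.forall]
    grind

open Finset in
theorem Derivation.iterate_leibniz {A : Type*} [CommRing A] [Algebra ℚ A] (d : Derivation ℚ A A)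
    (n : ℕ) (a b : A) :
    (d^[n]) (a * b) = ∑ x ∈ antidiagonal n, (n.choose x.1 : ℤ) • ((d^[x.1]) a * (d^[x.2]) b) := by
  induction n with
  | zero => simp
  | succ n ih =>
    rw [Function.iterate_succ_apply', ih]
    have := sum_antidiagonal_choose_succ_nsmul (fun i j => (d^[i]) a * (d^[j]) b) n
    simp only [natCast_zsmul]
    rw [this, map_sum, ← sum_add_distrib]
    refine sum_congr rfl fun x hx => ?_
    rw [HasAntidiagonal.mem_antidiagonal] at hx
    have hc : n.choose x.2 = n.choose x.1 := by
      rw [← hx, Nat.add_comm x.1, Nat.choose_symm_add.symm]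
    rw [hc, map_nsmul, ← nsmul_add, Derivation.leibniz, Function.iterate_succ_apply',
      Function.iterate_succ_apply', smul_eq_mul, smul_eq_mul, mul_comm ((d^[x.2]) b)]

theorem Ring.choose_mul_choose (x : ℤ) (m p : ℕ) :
    Ring.choose x m * Ring.choose (x - m) p = Ring.choose x (m + p) * ((m + p).choose m : ℤ) := by
  have := Ring.choose_smul_choose x (Nat.le_add_right m p)
  rw [Nat.add_sub_cancel_left] at this
  rw [← this, nsmul_eq_mul, mul_comm]

/-! ### Pseudo-differential operators: additive structure and associativity of the product. -/

namespace KP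

namespace PDO

variable {A : Type*} [CommRing A]

/-- The order of `P` is at most `N`. -/
def OrderLE (N : ℤ) (P : PDO A) : Prop := ∀ k : ℤ, N < k → P.coeff k = 0

theorem OrderLE.mono {N M : ℤ} {P : PDO A} (h : OrderLE N P) (hNM : N ≤ M) : OrderLE M P :=
  fun k hk => h k (by omega)

instance : Zero (PDO A) := ⟨⟨fun _ => 0, ⟨0, fun _ _ => rfl⟩⟩⟩

instance : Add (PDO A) := ⟨fun P Q => ⟨fun k => P.coeff k + Q.coeff k, by
  obtain ⟨N, hN⟩ := P.bounded
  obtain ⟨M, hM⟩ := Q.bounded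
  exact ⟨max N M, fun k hk => by rw [hN k (by omega), hM k (by omega), add_zero]⟩⟩⟩

instance : Neg (PDO A) := ⟨fun P => ⟨fun k => -P.coeff k, by
  obtain ⟨N, hN⟩ := P.bounded
  exact ⟨N, fun k hk => by rw [hN k hk, neg_zero]⟩⟩⟩

@[simp] theorem coeff_zero (k : ℤ) : (0 : PDO A).coeff k = 0 := rfl
@[simp] theorem coeff_add (P Q : PDO A) (k : ℤ) : (P + Q).coeff k = P.coeff k + Q.coeff k := rfl
@[simp] theorem coeff_neg (P : PDO A) (k : ℤ) : (-P).coeff k = -P.coeff k := rfl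

instance : AddCommGroup (PDO A) :=
  { AddGroup.ofLeftAxioms (G := PDO A) (fun P Q R => by ext k; simp [add_assoc])
      (fun P => by ext k; simp) (fun P => by ext k; simp) with
    add_comm := fun P Q => by ext k; simp [add_comm] }

/-- The coefficient of `D^k`, as an additive map. -/
def coeffHom (k : ℤ) : PDO A →+ A where
  toFun P := P.coeff k
  map_zero' := rfl
  map_add' _ _ := rfl

@[simp] theorem coeffHom_apply (k : ℤ) (P : PDO A) : coeffHom k P = P.coeff k := rfl

@[simp] theorem coeff_sub (P Q : PDO A) (k : ℤ) : (P - Q).coeff k = P.coeff k - Q.coeff k :=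
  map_sub (coeffHom k) P Q

theorem orderLE_monomial (n : ℤ) (a : A) : OrderLE n (monomial n a) :=
  fun k hk => if_neg (by omega)

theorem coeff_monomial (n k : ℤ) (a : A) : (monomial n a).coeff k = if k = n then a else 0 := rfl

theorem coeff_monomial_self (n : ℤ) (a : A) : (monomial n a).coeff n = a := if_pos rfl

/-- An additive map that vanishes on operators of low order and on monomials is zero. -/
theorem addHom_eq_zero {B : Type*} [AddCommGroup B] (f : PDO A →+ B) (n : ℤ)
    (hlow : ∀ P, OrderLE n P → f P = 0) (hmon : ∀ i a, f (monomial i a) = 0) (P : PDO A) :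
    f P = 0 := by
  obtain ⟨N, hN⟩ := P.bounded
  suffices h : ∀ (m : ℕ) (P : PDO A), OrderLE (n + m) P → f P = 0 from
    h (N - n).toNat P (OrderLE.mono (N := N) hN (by omega))
  intro m
  induction m with
  | zero => exact fun P hP => hlow P (by simpa using hP)
  | succ m ih =>
    intro P hP
    have h1 : OrderLE (n + m) (P - monomial (n + m + 1) (P.coeff (n + m + 1))) := by
      intro k hk
      rw [coeff_sub, coeff_monomial]
      split_ifs with h
      · rw [h, sub_self]
      · rw [hP k (by push_cast; omega), sub_zero]
    have h2 := ih _ h1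
    rwa [map_sub, hmon, sub_zero] at h2

/-- Orders are bounded above, so coefficients can be numbered by their depth n below the top order.
This turns the sums over ℤ × ℕ in products and adjoints into antidiagonal sums. -/
theorem ext_of_orderLE {P Q : PDO A} {N : ℤ} (hP : OrderLE N P) (hQ : OrderLE N Q)
    (h : ∀ n : ℕ, P.coeff (N - n) = Q.coeff (N - n)) : P = Q := by
  ext k
  by_cases hk : N < k
  · rw [hP k hk, hQ k hk]
  · have := h (N - k).toNat
    rwa [show N - ((N - k).toNat : ℤ) = k by omega] at this

section Mul

variable [Algebra ℚ A]

theorem iterate_zero (d : Derivation ℚ A A) (n : ℕ) : (d^[n]) (0 : A) = 0 :=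
  Function.iterate_fixed (map_zero d) _

theorem iterate_add (d : Derivation ℚ A A) (n : ℕ) (a b : A) :
    (d^[n]) (a + b) = (d^[n]) a + (d^[n]) b := by
  induction n with
  | zero => rfl
  | succ n ih => rw [Function.iterate_succ_apply', ih, map_add]; simp [Function.iterate_succ_apply']

theorem iterate_zsmul (d : Derivation ℚ A A) (n : ℕ) (z : ℤ) (a : A) :
    (d^[n]) (z • a) = z • (d^[n]) a := by
  induction n with
  | zero => rfl
  | succ n ih => rw [Function.iterate_succ_apply', ih, map_zsmul]; simp [Function.iterate_succ_apply']

theorem iterate_one (d : Derivation ℚ A A) {n : ℕ} (hn : n ≠ 0) : (d^[n]) (1 : A) = 0 := by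
  obtain ⟨n, rfl⟩ := Nat.exists_eq_succ_of_ne_zero hn
  rw [Function.iterate_succ_apply, Derivation.map_one_eq_zero, iterate_zero]

variable (d : Derivation ℚ A A)

theorem mul_term_eq_zero {P Q : PDO A} {N M : ℤ} (hP : OrderLE N P) (hQ : OrderLE M Q)
    (k : ℤ) (x : ℤ × ℕ) (hx : ¬(x.1 ≤ N ∧ k - x.1 + x.2 ≤ M)) :
    (Ring.choose x.1 x.2 : ℤ) • (P.coeff x.1 * (d^[x.2]) (Q.coeff (k - x.1 + x.2))) = 0 := by
  by_cases h : x.1 ≤ N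
  · rw [hQ _ (by omega), iterate_zero, mul_zero, smul_zero]
  · rw [hP _ (by omega), zero_mul, smul_zero]

theorem finite_mul_support (P Q : PDO A) (k : ℤ) : (Function.support fun x : ℤ × ℕ =>
    (Ring.choose x.1 x.2 : ℤ) •
      (P.coeff x.1 * (d^[x.2]) (Q.coeff (k - x.1 + x.2)))).Finite := by
  obtain ⟨N, hN⟩ := P.bounded
  obtain ⟨M, hM⟩ := Q.bounded
  refine ((Set.finite_Icc (k - M) N).prod (Set.finite_Iic (N + M - k).toNat)).subset ?_
  intro x hx
  by_contra h
  refine hx (mul_term_eq_zero d hN hM k x fun h' => h ?_)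
  simp only [Set.mem_prod, Set.mem_Icc, Set.mem_Iic]
  omega

theorem mul_add' (P Q R : PDO A) : mul d P (Q + R) = mul d P Q + mul d P R := by
  ext k
  rw [coeff_add]
  simp only [mul]
  rw [← finsum_add_distrib (finite_mul_support d P Q k) (finite_mul_support d P R k)]
  refine finsum_congr fun x => ?_
  rw [coeff_add, iterate_add, mul_add, smul_add]

theorem add_mul' (P Q R : PDO A) : mul d (P + Q) R = mul d P R + mul d Q R := by
  ext k
  rw [coeff_add]
  simp only [mul]
  rw [← finsum_add_distrib (finite_mul_support d P R k) (finite_mul_support d Q R k)]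
  refine finsum_congr fun x => ?_
  rw [coeff_add, add_mul, smul_add]

theorem OrderLE.mul {P Q : PDO A} {N M : ℤ} (hP : OrderLE N P) (hQ : OrderLE M Q) :
    OrderLE (N + M) (mul d P Q) := by
  intro k hk
  simp only [PDO.mul]
  rw [← finsum_zero (α := ℤ × ℕ)]
  exact finsum_congr fun x => mul_term_eq_zero d hP hQ k x (by omega)

/-- Multiplication as a biadditive map. -/
noncomputable def mulHom : PDO A →+ PDO A →+ PDO A :=
  AddMonoidHom.mk' (fun P => AddMonoidHom.mk' (fun Q => mul d P Q) (mul_add' d P))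
    fun P Q => by ext1 R; exact add_mul' d P Q R

@[simp] theorem mulHom_apply (P Q : PDO A) : mulHom d P Q = mul d P Q := rfl

open Finset

/-- The total depth n is shared between the number `x.1` of derivatives falling on the coefficient
of `Q` and the depth `x.2` of that coefficient. -/
theorem coeff_monomial_mul {Q : PDO A} {M : ℤ} (hQ : OrderLE M Q) (i : ℤ) (a : A) (n : ℕ) :
    (mul d (monomial i a) Q).coeff (i + M - n) =
      ∑ x ∈ antidiagonal n, (Ring.choose i x.1 : ℤ) • (a * (d^[x.1]) (Q.coeff (M - x.2))) := by
  simp only [mul]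
  rw [finsum_eq_sum_of_support_subset (s := (antidiagonal n).image fun x => (i, x.1))]
  · rw [sum_image]
    · refine sum_congr rfl fun x hx => ?_
      rw [HasAntidiagonal.mem_antidiagonal] at hx
      simp only [coeff_monomial_self]
      rw [show i + M - n - i + x.1 = M - x.2 by omega]
    · intro x hx y hy hxy
      simp only [mem_coe, HasAntidiagonal.mem_antidiagonal, Prod.mk.injEq, true_and] at hx hy hxy
      ext <;> omega
  · intro x hx
    rw [Function.mem_support] at hx
    have h1 : x.1 = i := by
      by_contra h
      rw [coeff_monomial, if_neg h, zero_mul, smul_zero] at hx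
      exact hx rfl
    have h2 : x.2 ≤ n := by
      by_contra h
      exact hx (mul_term_eq_zero d (orderLE_monomial i a) hQ _ x (by omega))
    simp only [coe_image, Set.mem_image, mem_coe, HasAntidiagonal.mem_antidiagonal]
    exact ⟨(x.2, n - x.2), by simp; omega, by ext <;> simp [h1]⟩

theorem coeff_mul_monomial {P : PDO A} {N : ℤ} (hP : OrderLE N P) (j : ℤ) (b : A) (n : ℕ) :
    (mul d P (monomial j b)).coeff (N + j - n) =
      ∑ x ∈ antidiagonal n,
        (Ring.choose (N - x.2) x.1 : ℤ) • (P.coeff (N - x.2) * (d^[x.1]) b) := by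
  simp only [mul]
  rw [finsum_eq_sum_of_support_subset (s := (antidiagonal n).image fun x => (N - x.2, x.1))]
  · rw [sum_image]
    · refine sum_congr rfl fun x hx => ?_
      rw [HasAntidiagonal.mem_antidiagonal] at hx
      rw [show N + j - n - (N - x.2) + x.1 = j by omega, coeff_monomial_self]
    · intro x hx y hy hxy
      simp only [mem_coe, HasAntidiagonal.mem_antidiagonal, Prod.mk.injEq] at hx hy hxy
      ext <;> omega
  · intro x hx
    rw [Function.mem_support] at hx
    have h1 : N + j - n - x.1 + x.2 = j := by
      by_contra h
      rw [coeff_monomial, if_neg h, iterate_zero, mul_zero, smul_zero] at hx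
      exact hx rfl
    have h2 : x.1 ≤ N := by
      by_contra h
      exact hx (mul_term_eq_zero d hP (orderLE_monomial j b) _ x (by omega))
    simp only [coe_image, Set.mem_image, mem_coe, HasAntidiagonal.mem_antidiagonal]
    exact ⟨(x.2, (N - x.1).toNat), by simp; omega, by ext <;> simp; omega⟩

theorem coeff_monomial_mul_monomial (i j : ℤ) (a b : A) (n : ℕ) :
    (mul d (monomial i a) (monomial j b)).coeff (i + j - n) =
      (Ring.choose i n : ℤ) • (a * (d^[n]) b) := by
  rw [coeff_monomial_mul d (orderLE_monomial j b), sum_eq_single (n, 0)]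
  · simp [coeff_monomial_self]
  · rintro ⟨p, q⟩ hx hne
    rw [HasAntidiagonal.mem_antidiagonal] at hx
    have : q ≠ 0 := by rintro rfl; simp at hx; exact hne (by rw [hx])
    rw [coeff_monomial, if_neg (by simpa using this), iterate_zero, mul_zero, smul_zero]
  · simp

/-- Expanding the right side by the Leibniz rule gives a sum over p + q + s = n of terms a · d^p b ·
d^(q+s) c. Once the binomials are regrouped by `Ring.choose_mul_choose`, the Chu–Vandermonde
identity sums over q + s and yields the left side. -/
theorem monomial_mul_assoc (i j l : ℤ) (a b c : A) :
    mul d (mul d (monomial i a) (monomial j b)) (monomial l c) =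
      mul d (monomial i a) (mul d (monomial j b) (monomial l c)) := by
  have hL : OrderLE (i + j) (mul d (monomial i a) (monomial j b)) :=
    (orderLE_monomial i a).mul d (orderLE_monomial j b)
  have hR : OrderLE (j + l) (mul d (monomial j b) (monomial l c)) :=
    (orderLE_monomial j b).mul d (orderLE_monomial l c)
  refine ext_of_orderLE (N := i + j + l) (hL.mul d (orderLE_monomial l c))
    (((orderLE_monomial i a).mul d hR).mono (by omega)) fun n => ?_
  rw [coeff_mul_monomial d hL, show i + j + l - (n : ℤ) = i + (j + l) - n by ring,
    coeff_monomial_mul d hR]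
  simp only [coeff_monomial_mul_monomial, iterate_zsmul, Derivation.iterate_leibniz]
  have h1 : ∀ x ∈ antidiagonal n, (Ring.choose i x.1 : ℤ) • (a * (Ring.choose j x.2 : ℤ) •
      ∑ y ∈ antidiagonal x.1, (x.1.choose y.1 : ℤ) • ((d^[y.1]) b * (d^[y.2]) ((d^[x.2]) c))) =
      ∑ y ∈ antidiagonal x.1, (Ring.choose i y.1 *
        (Ring.choose (i - y.1) y.2 * Ring.choose j x.2) : ℤ) •
        (a * ((d^[y.1]) b * (d^[y.2 + x.2]) c)) := by
    intro x _
    rw [smul_sum, mul_sum, smul_sum]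
    refine sum_congr rfl fun y hy => ?_
    rw [HasAntidiagonal.mem_antidiagonal] at hy
    rw [← mul_assoc (Ring.choose i y.1), Ring.choose_mul_choose, hy, Function.iterate_add_apply]
    simp only [mul_smul_comm, smul_smul]
    congr 1
    ring
  rw [sum_congr rfl h1, sum_antidiagonal_assoc n (fun p q s => (Ring.choose i p *
        (Ring.choose (i - p) q * Ring.choose j s) : ℤ) •
        (a * ((d^[p]) b * (d^[q + s]) c))), ← Nat.sum_antidiagonal_swap]
  refine sum_congr rfl fun x _ => ?_
  have h2 : ∀ y ∈ antidiagonal x.2, (Ring.choose i x.1 *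
        (Ring.choose (i - x.1) y.1 * Ring.choose j y.2) : ℤ) •
        (a * ((d^[x.1]) b * (d^[y.1 + y.2]) c)) = (Ring.choose i x.1 *
        (Ring.choose (i - x.1) y.1 * Ring.choose j y.2) : ℤ) •
        (a * ((d^[x.1]) b * (d^[x.2]) c)) := by
    intro y hy
    rw [HasAntidiagonal.mem_antidiagonal] at hy
    rw [hy]
  rw [sum_congr rfl h2, ← sum_smul, ← mul_sum, ← Ring.add_choose_eq _ (Commute.all _ _)]
  simp only [Prod.fst_swap, Prod.snd_swap, smul_mul_assoc, smul_smul, mul_assoc]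
  rw [show i - (x.1 : ℤ) + j = i + j - x.1 by ring, mul_comm (Ring.choose i x.1)]

/-- A fixed coefficient of the associator is additive in each factor and vanishes when that factor
has low enough order. `addHom_eq_zero` therefore replaces the factors by monomials one at a time,
generalizing first `R`, then `Q`, then `P`. -/
theorem mul_assoc' (P Q R : PDO A) : mul d (mul d P Q) R = mul d P (mul d Q R) := by
  ext k
  obtain ⟨N, hN⟩ := P.bounded
  obtain ⟨M, hM⟩ := Q.bounded
  obtain ⟨K, hK⟩ := R.bounded
  replace hN : OrderLE N P := hN
  replace hM : OrderLE M Q := hM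
  replace hK : OrderLE K R := hK
  have low : ∀ {P Q R : PDO A} {N M K : ℤ}, OrderLE N P → OrderLE M Q → OrderLE K R →
      N + M + K < k → (mul d (mul d P Q) R).coeff k = 0 ∧
        (mul d P (mul d Q R)).coeff k = 0 := fun hP hQ hR h =>
    ⟨(hP.mul d hQ).mul d hR k h, hP.mul d (hQ.mul d hR) k (by omega)⟩
  have step1 : ∀ (i j l : ℤ) (a b c : A),
      (mul d (mul d (monomial i a) (monomial j b)) (monomial l c)).coeff k -
        (mul d (monomial i a) (mul d (monomial j b) (monomial l c))).coeff k = 0 := by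
    intro i j l a b c; rw [monomial_mul_assoc, sub_self]
  have step2 : ∀ (i j : ℤ) (a b : A),
      (mul d (mul d (monomial i a) (monomial j b)) R).coeff k -
        (mul d (monomial i a) (mul d (monomial j b) R)).coeff k = 0 := by
    intro i j a b
    refine addHom_eq_zero ((coeffHom k).comp (mulHom d (mul d (monomial i a) (monomial j b))) -
      (coeffHom k).comp ((mulHom d (monomial i a)).comp (mulHom d (monomial j b))))
      -- The threshold makes the order of the triple product at most k - 1, so both bracketings have
      -- zero coefficient at k.
      (k - i - j - 1) (fun R hR => ?_) (fun l c => step1 i j l a b c) R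
    have := low (orderLE_monomial i a) (orderLE_monomial j b) hR (by omega)
    simp [this.1, this.2]
  have step3 : ∀ (i : ℤ) (a : A),
      (mul d (mul d (monomial i a) Q) R).coeff k -
        (mul d (monomial i a) (mul d Q R)).coeff k = 0 := by
    intro i a
    refine addHom_eq_zero ((coeffHom k).comp (((mulHom d).flip R).comp (mulHom d (monomial i a))) -
      (coeffHom k).comp ((mulHom d (monomial i a)).comp ((mulHom d).flip R)))
      (k - i - K - 1) (fun Q hQ => ?_) (fun j b => step2 i j a b) Q
    have := low (orderLE_monomial i a) hQ hK (by omega)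
    simp [this.1, this.2]
  refine sub_eq_zero.mp (addHom_eq_zero
    ((coeffHom k).comp (((mulHom d).flip R).comp ((mulHom d).flip Q)) -
      (coeffHom k).comp ((mulHom d).flip (mul d Q R)))
      (k - M - K - 1) (fun P hP => ?_) (fun i a => step3 i a) P)
  have := low hP hM hK (by omega)
  simp [this.1, this.2]

theorem coeff_C_mul (a : A) (Q : PDO A) (k : ℤ) :
    (mul d (monomial 0 a) Q).coeff k = a * Q.coeff k := by
  simp only [mul]
  rw [finsum_eq_single _ ((0 : ℤ), 0)]
  · simp [coeff_monomial_self]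
  · rintro ⟨i, m⟩ hx
    by_cases hi : i = 0
    · subst hi
      have : m ≠ 0 := by rintro rfl; exact hx rfl
      rw [Ring.choose_zero_pos _ (Nat.pos_of_ne_zero this), zero_smul]
    · rw [coeff_monomial, if_neg hi, zero_mul, smul_zero]

theorem coeff_mul_D (P : PDO A) (j k : ℤ) :
    (mul d P (monomial j 1)).coeff k = P.coeff (k - j) := by
  simp only [mul]
  rw [finsum_eq_single _ (k - j, 0)]
  · simp [coeff_monomial]
  · rintro ⟨i, m⟩ hx
    simp only [coeff_monomial]
    split_ifs with h
    · have : m ≠ 0 := by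
        rintro rfl
        refine hx ?_
        simp at h ⊢; omega
      rw [iterate_one d this, mul_zero, smul_zero]
    · rw [iterate_zero, mul_zero, smul_zero]

end Mul

end PDO

end KP

/-! ### Formal adjoint, residue and coefficientwise derivations. -/

namespace KP

namespace PDO

variable {A : Type*} [CommRing A]

/-- Two additive maps of bounded degree that agree on monomials are equal. -/
theorem addHom_congr (f g : PDO A →+ PDO A) (c : ℤ)
    (hf : ∀ N P, OrderLE N P → OrderLE (N + c) (f P))
    (hg : ∀ N P, OrderLE N P → OrderLE (N + c) (g P))
    (hmon : ∀ i a, f (monomial i a) = g (monomial i a)) (P : PDO A) : f P = g P := by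
  ext k
  refine sub_eq_zero.mp (Eq.trans (by simp) (addHom_eq_zero ((coeffHom k).comp (f - g))
    (k - c - 1) (fun P hP => ?_) (fun i a => ?_) P))
  · simp [hf _ P hP k (by omega), hg _ P hP k (by omega)]
  · simp [hmon]

theorem coeff_zsmul (z : ℤ) (P : PDO A) (k : ℤ) : (z • P).coeff k = z • P.coeff k :=
  map_zsmul (coeffHom k) z P

theorem OrderLE.zsmul {N : ℤ} {P : PDO A} (hP : OrderLE N P) (z : ℤ) : OrderLE N (z • P) :=
  fun k hk => by rw [coeff_zsmul, hP k hk, smul_zero]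

theorem monomial_add (n : ℤ) (a b : A) : monomial n (a + b) = monomial n a + monomial n b := by
  ext k; simp only [coeff_monomial, coeff_add]; split_ifs <;> simp

variable [Algebra ℚ A] (d : Derivation ℚ A A)

theorem adjoint_term_eq_zero {P : PDO A} {N : ℤ} (hP : OrderLE N P) (k : ℤ) (m : ℕ)
    (h : N < k + m) :
    (((k + m).negOnePow : ℤ) * Ring.choose (k + m) m) • (d^[m]) (P.coeff (k + m)) = 0 := by
  rw [hP _ h, iterate_zero, smul_zero]

theorem finite_adjoint_support (P : PDO A) (k : ℤ) : (Function.support fun m : ℕ =>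
    (((k + m).negOnePow : ℤ) * Ring.choose (k + m) m) • (d^[m]) (P.coeff (k + m))).Finite := by
  obtain ⟨N, hN⟩ := P.bounded
  refine (Set.finite_Iic (N - k).toNat).subset fun m hm => ?_
  by_contra h
  refine hm (adjoint_term_eq_zero d hN k m ?_)
  simp only [Set.mem_Iic] at h
  omega

theorem OrderLE.adjoint {P : PDO A} {N : ℤ} (hP : OrderLE N P) : OrderLE N (adjoint d P) := by
  intro k hk
  simp only [PDO.adjoint]
  rw [← finsum_zero (α := ℕ)]
  exact finsum_congr fun m => adjoint_term_eq_zero d hP k m (by omega)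

theorem adjoint_add (P Q : PDO A) : adjoint d (P + Q) = adjoint d P + adjoint d Q := by
  ext k
  rw [coeff_add]
  simp only [adjoint]
  rw [← finsum_add_distrib (finite_adjoint_support d P k) (finite_adjoint_support d Q k)]
  refine finsum_congr fun x => ?_
  rw [coeff_add, iterate_add, smul_add]

open Finset

theorem coeff_adjoint {P : PDO A} {N : ℤ} (hP : OrderLE N P) (n : ℕ) :
    (adjoint d P).coeff (N - n) = ∑ x ∈ antidiagonal n,
      (((N - x.2).negOnePow : ℤ) * Ring.choose (N - x.2) x.1) •
        (d^[x.1]) (P.coeff (N - x.2)) := by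
  simp only [adjoint]
  rw [finsum_eq_sum_of_support_subset (s := range (n + 1)),
    Nat.sum_antidiagonal_eq_sum_range_succ (fun i j =>
      (((N - j).negOnePow : ℤ) * Ring.choose (N - j) i) • (d^[i]) (P.coeff (N - j)))]
  · refine sum_congr rfl fun m hm => ?_
    rw [mem_range] at hm
    rw [show N - n + m = N - ((n - m : ℕ) : ℤ) by omega]
  · intro m hm
    rw [mem_coe, mem_range]
    by_contra h
    exact hm (adjoint_term_eq_zero d hP _ m (by omega))

theorem adjoint_monomial (i : ℤ) (a : A) : adjoint d (monomial i a) =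
    (i.negOnePow : ℤ) • mul d (monomial i 1) (monomial 0 a) := by
  refine ext_of_orderLE ((orderLE_monomial i a).adjoint d) (OrderLE.zsmul (OrderLE.mono
    ((orderLE_monomial i 1).mul d (orderLE_monomial 0 a)) (by omega)) _) fun n => ?_
  have h := coeff_monomial_mul_monomial d i 0 1 a n
  rw [add_zero] at h
  rw [coeff_adjoint d (orderLE_monomial i a), coeff_zsmul, h, sum_eq_single (n, 0)]
  · simp [coeff_monomial_self, mul_assoc]
  · rintro ⟨p, q⟩ hx hne
    rw [HasAntidiagonal.mem_antidiagonal] at hx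
    have : q ≠ 0 := by rintro rfl; simp at hx; exact hne (by rw [hx])
    rw [coeff_monomial, if_neg (by simpa using this), iterate_zero, smul_zero]
  · simp

/-- Each term at depth n is (i choose n) d^n b times a signed binomial (-1)^j (n choose j); the
alternating sum over j vanishes unless n = 0. -/
theorem adjoint_D_mul (i : ℤ) (b : A) : adjoint d (mul d (monomial i 1) (monomial 0 b)) =
    (i.negOnePow : ℤ) • monomial i b := by
  have hO : OrderLE i (mul d (monomial i 1) (monomial 0 b)) :=
    OrderLE.mono ((orderLE_monomial i 1).mul d (orderLE_monomial 0 b)) (by omega)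
  refine ext_of_orderLE (hO.adjoint d) (OrderLE.zsmul (orderLE_monomial i b) _) fun n => ?_
  have h := coeff_monomial_mul_monomial d i 0 1 b
  simp only [add_zero] at h
  rw [coeff_adjoint d hO, coeff_zsmul]
  have h1 : ∀ x ∈ antidiagonal n, (((i - x.2).negOnePow : ℤ) * Ring.choose (i - x.2) x.1) •
        (d^[x.1]) ((mul d (monomial i 1) (monomial 0 b)).coeff (i - x.2)) =
        ((-1) ^ x.2 * (n.choose x.2 : ℤ)) •
          ((i.negOnePow : ℤ) * Ring.choose i n) • (d^[n]) b := by
    intro x hx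
    rw [HasAntidiagonal.mem_antidiagonal] at hx
    have h2 := Ring.choose_mul_choose i x.2 x.1
    rw [add_comm x.2, hx] at h2
    rw [h, iterate_zsmul, one_mul, ← Function.iterate_add_apply, hx, smul_smul, smul_smul,
      mul_assoc, mul_comm (Ring.choose _ x.1), h2, Int.negOnePow_sub]
    simp only [Units.val_mul, Int.coe_negOnePow_natCast]
    congr 1
    ring
  rw [sum_congr rfl h1, ← sum_smul, ← Nat.sum_antidiagonal_swap]
  simp only [Prod.snd_swap]
  rw [Nat.sum_antidiagonal_eq_sum_range_succ (fun i _ => (-1) ^ i * (n.choose i : ℤ)),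
    Int.alternating_sum_range_choose]
  rcases Nat.eq_zero_or_pos n with rfl | hn
  · simp [coeff_monomial_self]
  · rw [if_neg (by omega), zero_smul, coeff_monomial, if_neg (by omega), smul_zero]

/-- In the coefficient of D⁻¹ the binomial is (m-1 choose m), which is zero for m ≥ 1; the term m =
0 carries the sign of (-1)⁻¹. -/
theorem res_adjoint (P : PDO A) : res (adjoint d P) = -res P := by
  simp only [res, adjoint]
  rw [finsum_eq_single _ 0]
  · simp
  · intro m hm
    obtain ⟨m, rfl⟩ := Nat.exists_eq_succ_of_ne_zero hm
    rw [show (-1 : ℤ) + ((m.succ : ℕ) : ℤ) = (m : ℤ) by push_cast; ring, Ring.choose_natCast,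
      Nat.choose_succ_self]
    simp

variable {d} in
theorem derivation_coeff_mul {δ : Derivation ℚ A A} (hδ : ∀ f, δ (d f) = d (δ f))
    {P P' Q Q' : PDO A} (hP : ∀ k, P'.coeff k = δ (P.coeff k))
    (hQ : ∀ k, Q'.coeff k = δ (Q.coeff k)) (k : ℤ) :
    δ ((mul d P Q).coeff k) = (mul d P' Q).coeff k + (mul d P Q').coeff k := by
  have hit : ∀ m f, δ ((d^[m]) f) = (d^[m]) (δ f) := by
    intro m f
    induction m with
    | zero => rfl
    | succ m ih => rw [Function.iterate_succ_apply', hδ, ih, Function.iterate_succ_apply']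
  simp only [PDO.mul]
  rw [show δ _ = (δ : A →ₗ[ℚ] A).toAddMonoidHom _ from rfl,
    AddMonoidHom.map_finsum _ (finite_mul_support d P Q k),
    ← finsum_add_distrib (finite_mul_support d P' Q k) (finite_mul_support d P Q' k)]
  refine finsum_congr fun x => ?_
  rw [hP, hQ, ← hit, ← smul_add]
  change δ _ = _
  rw [map_zsmul, Derivation.leibniz, smul_eq_mul, smul_eq_mul, add_comm, mul_comm _ (δ _)]

/-- The ring of pseudo-differential operators over `A`, with `D a = a D + d a`. -/
def Op (_d : Derivation ℚ A A) : Type _ := PDO A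

instance : AddCommGroup (Op d) := inferInstanceAs (AddCommGroup (PDO A))

noncomputable instance : Ring (Op d) :=
  { (inferInstance : AddCommGroup (Op d)) with
    mul := mul d
    one := monomial 0 1
    left_distrib := mul_add' d
    right_distrib := add_mul' d
    zero_mul := fun P => by
      have := map_zero ((mulHom d).flip P); exact this
    mul_zero := fun P => map_zero (mulHom d P)
    mul_assoc := mul_assoc' d
    one_mul := fun P => PDO.ext (funext fun k => by
      refine (coeff_C_mul d 1 P k).trans (one_mul _))
    mul_one := fun P => PDO.ext (funext fun k => by
      refine (coeff_mul_D d P 0 k).trans (by rw [sub_zero])) }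

variable {d}

/-! ### Calculus in the operator ring: functions, powers of `D`, adjoints, residues, differential
parts. -/

namespace Op

/-- The coefficient of `D^k`. -/
def coeff (P : Op d) (k : ℤ) : A := PDO.coeff P k

@[ext] theorem ext {P Q : Op d} (h : ∀ k, P.coeff k = Q.coeff k) : P = Q :=
  PDO.ext (funext h)

theorem pow_eq (P : Op d) (n : ℕ) : P ^ n = pow d P n := by
  induction n with
  | zero => rw [pow_zero]; rfl
  | succ n ih => rw [pow_succ, ih]; rfl

@[simp] theorem coeff_zero (k : ℤ) : (0 : Op d).coeff k = 0 := rfl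
@[simp] theorem coeff_add (P Q : Op d) (k : ℤ) : (P + Q).coeff k = P.coeff k + Q.coeff k := rfl
@[simp] theorem coeff_neg (P : Op d) (k : ℤ) : (-P).coeff k = -P.coeff k := rfl
@[simp] theorem coeff_sub (P Q : Op d) (k : ℤ) : (P - Q).coeff k = P.coeff k - Q.coeff k := by
  rw [sub_eq_add_neg, coeff_add, coeff_neg, sub_eq_add_neg]

/-- The coefficient of `D^k`, as an additive map. -/
noncomputable def coeffHom (k : ℤ) : Op d →+ A := AddMonoidHom.mk' (fun P => P.coeff k) fun _ _ => rfl

theorem coeff_sum {ι : Type*} (s : Finset ι) (f : ι → Op d) (k : ℤ) :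
    (∑ i ∈ s, f i).coeff k = ∑ i ∈ s, (f i).coeff k := map_sum (coeffHom k) f s

theorem coeff_zsmul (z : ℤ) (P : Op d) (k : ℤ) : (z • P).coeff k = z • P.coeff k :=
  map_zsmul (coeffHom k) z P

/-- The order of `P` is at most `N`. -/
def OrdLE (N : ℤ) (P : Op d) : Prop := ∀ k : ℤ, N < k → P.coeff k = 0

theorem exists_ordLE (P : Op d) : ∃ N, OrdLE N P := PDO.bounded P

theorem OrdLE.mono {N M : ℤ} {P : Op d} (h : OrdLE N P) (hNM : N ≤ M) : OrdLE M P :=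
  fun k hk => h k (by omega)

theorem ordLE_zero (N : ℤ) : OrdLE N (0 : Op d) := fun _ _ => rfl

theorem OrdLE.add {N : ℤ} {P Q : Op d} (hP : OrdLE N P) (hQ : OrdLE N Q) :
    OrdLE N (P + Q) := fun k hk => by rw [coeff_add, hP k hk, hQ k hk, add_zero]

theorem OrdLE.neg {N : ℤ} {P : Op d} (hP : OrdLE N P) :
    OrdLE N (-P) := fun k hk => by rw [coeff_neg, hP k hk, neg_zero]

theorem OrdLE.sub {N : ℤ} {P Q : Op d} (hP : OrdLE N P) (hQ : OrdLE N Q) :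
    OrdLE N (P - Q) := fun k hk => by rw [coeff_sub, hP k hk, hQ k hk, sub_zero]

theorem OrdLE.sum {N : ℤ} {ι : Type*} {s : Finset ι} {f : ι → Op d}
    (h : ∀ i ∈ s, OrdLE N (f i)) : OrdLE N (∑ i ∈ s, f i) := fun k hk => by
  rw [coeff_sum]; exact Finset.sum_eq_zero fun i hi => h i hi k hk

theorem OrdLE.zsmul {N : ℤ} {P : Op d} (hP : OrdLE N P) (z : ℤ) : OrdLE N (z • P) :=
  fun k hk => by rw [coeff_zsmul, hP k hk, smul_zero]

theorem OrdLE.mul {P Q : Op d} {N M : ℤ} (hP : OrdLE N P) (hQ : OrdLE M Q) :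
    OrdLE (N + M) (P * Q) := OrderLE.mul d hP hQ

theorem eq_zero_of_ordLE {P : Op d} (h : ∀ N, OrdLE N P) : P = 0 :=
  ext fun k => h (k - 1) k (by omega)

variable (d)

/-- The inclusion of functions into operators. -/
noncomputable def C : A →+* Op d where
  toFun a := (monomial 0 a : PDO A)
  map_one' := rfl
  map_mul' a b := by
    ext k
    refine Eq.trans ?_ (coeff_C_mul d a (monomial 0 b) k).symm
    change (if k = 0 then a * b else 0) = a * (if k = 0 then b else 0)
    split_ifs <;> simp
  map_zero' := by ext k; exact ite_self _
  map_add' := monomial_add 0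

/-- The operator `D^j`. -/
def D (j : ℤ) : Op d := (monomial j 1 : PDO A)

variable {d}

theorem coeff_C_mul (a : A) (P : Op d) (k : ℤ) :
    (C d a * P).coeff k = a * P.coeff k := PDO.coeff_C_mul d a P k

theorem coeff_mul_D (P : Op d) (j k : ℤ) :
    (P * D d j).coeff k = P.coeff (k - j) := PDO.coeff_mul_D d P j k

theorem coeff_C (a : A) (k : ℤ) : (C d a).coeff k = if k = 0 then a else 0 := rfl

theorem coeff_D (j k : ℤ) : (D d j).coeff k = if k = j then 1 else 0 := rfl

theorem D_mul_D (i j : ℤ) : D d i * D d j = D d (i + j) := by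
  ext k
  rw [coeff_mul_D, coeff_D, coeff_D]
  exact if_congr (by omega) rfl rfl

theorem D_zero : D d 0 = 1 := rfl

theorem C_mul_D (a : A) (j : ℤ) : C d a * D d j = (monomial j a : PDO A) := by
  refine ext fun k => ?_
  rw [coeff_C_mul, coeff_D]
  change _ = if k = j then a else 0
  split_ifs <;> simp

theorem ordLE_C (a : A) : OrdLE 0 (C d a) := orderLE_monomial 0 a

theorem ordLE_D (j : ℤ) : OrdLE j (D d j) := orderLE_monomial j 1

/-- `D a = a D + d a`. -/
theorem D_mul_C (a : A) : D d 1 * C d a = C d a * D d 1 + C d (d a) := by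
  refine ext_of_orderLE (N := 1) (((ordLE_D 1).mul (ordLE_C a)).mono (by omega))
    (OrdLE.add (((ordLE_C a).mul (ordLE_D 1)).mono (by omega))
      ((ordLE_C (d a)).mono (by omega))) fun n => ?_
  have h := coeff_monomial_mul_monomial d 1 0 1 a n
  rw [add_zero] at h
  refine h.trans ?_
  change _ = (C d a * D d 1 + C d (d a)).coeff (1 - n)
  rw [coeff_add, coeff_mul_D, coeff_C, coeff_C]
  have h1 : Ring.choose (1 : ℤ) n = (Nat.choose 1 n : ℤ) := by
    exact_mod_cast Ring.choose_natCast (R := ℤ) 1 n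
  rw [h1]
  rcases n with _ | _ | n
  · simp
  · simp
  · rw [Nat.choose_eq_zero_of_lt (by omega), if_neg (by push_cast; omega),
      if_neg (by push_cast; omega)]
    simp

variable (d) in
/-- The formal adjoint as an additive map. -/
noncomputable def adj : Op d →+ Op d := AddMonoidHom.mk' (adjoint d) (adjoint_add d)

theorem adj_C_mul_D (a : A) (i : ℤ) :
    adj d (C d a * D d i) = (i.negOnePow : ℤ) • (D d i * C d a) := by
  rw [C_mul_D]; exact adjoint_monomial d i a

theorem adj_D_mul_C (b : A) (i : ℤ) :
    adj d (D d i * C d b) = (i.negOnePow : ℤ) • (C d b * D d i) := by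
  rw [C_mul_D]; exact adjoint_D_mul d i b

theorem addHom_congr (f g : Op d →+ Op d) (c : ℤ)
    (hf : ∀ N P, OrdLE N P → OrdLE (N + c) (f P))
    (hg : ∀ N P, OrdLE N P → OrdLE (N + c) (g P))
    (hmon : ∀ i a, f (C d a * D d i) = g (C d a * D d i)) (P : Op d) : f P = g P :=
  PDO.addHom_congr f g c hf hg (fun i a => by have := hmon i a; rwa [C_mul_D] at this) P

theorem OrdLE.adj {N : ℤ} {P : Op d} (h : OrdLE N P) : OrdLE N (adj d P) :=
  OrderLE.adjoint d h

theorem adj_mul_D (X : Op d) (j : ℤ) :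
    adj d (X * D d j) = (j.negOnePow : ℤ) • (D d j * adj d X) := by
  refine addHom_congr ((adj d).comp (AddMonoidHom.mulRight (D d j)))
    ((j.negOnePow : ℤ) • ((AddMonoidHom.mulLeft (D d j)).comp (adj d))) j ?_ ?_ ?_ X
  · exact fun N P hP => (hP.mul (ordLE_D j)).adj
  · exact fun N P hP => OrdLE.zsmul (((ordLE_D j).mul hP.adj).mono (by omega)) _
  · intro i a
    change adj d (C d a * D d i * D d j) =
      (j.negOnePow : ℤ) • (D d j * adj d (C d a * D d i))
    rw [mul_assoc, D_mul_D, adj_C_mul_D, adj_C_mul_D, mul_smul_comm, smul_smul, ← mul_assoc,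
      D_mul_D, Int.negOnePow_add, Units.val_mul, add_comm i, mul_comm (i.negOnePow : ℤ)]

theorem adj_C_mul (a : A) (X : Op d) : adj d (C d a * X) = adj d X * C d a := by
  refine addHom_congr ((adj d).comp (AddMonoidHom.mulLeft (C d a)))
    ((AddMonoidHom.mulRight (C d a)).comp (adj d)) 0 ?_ ?_ ?_ X
  · exact fun N P hP => (((ordLE_C a).mul hP).mono (by omega)).adj
  · exact fun N P hP => hP.adj.mul (ordLE_C a)
  · intro i b
    change adj d (C d a * (C d b * D d i)) = adj d (C d b * D d i) * C d a
    rw [← mul_assoc, ← map_mul, adj_C_mul_D, adj_C_mul_D, smul_mul_assoc, mul_assoc, ← map_mul,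
      mul_comm a]

/-- Both sides are additive and of bounded degree in each factor, so monomials suffice. There the
only real computation is the adjoint of D^i b, which is `adj_D_mul_C`. -/
theorem adj_mul (P Q : Op d) : adj d (P * Q) = adj d Q * adj d P := by
  have h1 : ∀ (j : ℤ) (b : A) (P : Op d), adj d (P * (C d b * D d j)) =
      adj d (C d b * D d j) * adj d P := by
    intro j b P
    refine addHom_congr ((adj d).comp (AddMonoidHom.mulRight (C d b * D d j)))
      ((AddMonoidHom.mulLeft (adj d (C d b * D d j))).comp (adj d)) j ?_ ?_ ?_ P
    · exact fun N P hP => ((hP.mul ((ordLE_C b).mul (ordLE_D j))).mono (by omega)).adj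
    · exact fun N P hP => (((ordLE_C b).mul (ordLE_D j)).adj.mul hP.adj).mono (by omega)
    · intro i a
      change adj d (C d a * D d i * (C d b * D d j)) =
        adj d (C d b * D d j) * adj d (C d a * D d i)
      rw [show C d a * D d i * (C d b * D d j) =
        (C d a * (D d i * C d b)) * D d j by simp only [mul_assoc], adj_mul_D,
        adj_C_mul, adj_D_mul_C, adj_C_mul_D, adj_C_mul_D]
      simp only [mul_smul_comm, smul_mul_assoc, mul_assoc]
      rw [smul_comm]
  obtain ⟨N, hN⟩ := P.exists_ordLE
  refine addHom_congr ((adj d).comp (AddMonoidHom.mulLeft P))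
    ((AddMonoidHom.mulRight (adj d P)).comp (adj d)) N ?_ ?_ (fun i a => h1 i a P) Q
  · exact fun M Q hQ => ((hN.mul hQ).mono (by omega)).adj
  · exact fun M Q hQ => hQ.adj.mul hN.adj

theorem adj_C (a : A) : adj d (C d a) = C d a := by
  have := adj_C_mul_D (d := d) a 0
  simpa [D_zero] using this

theorem adj_D (j : ℤ) : adj d (D d j) = (j.negOnePow : ℤ) • D d j := by
  have := adj_C_mul_D (d := d) 1 j
  rwa [map_one, one_mul, mul_one] at this

theorem adj_pow (P : Op d) (n : ℕ) : adj d (P ^ n) = adj d P ^ n := by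
  induction n with
  | zero => rw [pow_zero, pow_zero, ← map_one (C d), adj_C]
  | succ n ih => rw [pow_succ, adj_mul, ih, pow_succ']

/-- The residue as an additive map. -/
noncomputable def res : Op d →+ A := coeffHom (-1)

theorem res_apply (P : Op d) : res P = P.coeff (-1) := rfl

theorem res_adj (P : Op d) : res (adj d P) = -res P := res_adjoint d P

theorem res_C_mul (a : A) (P : Op d) : res (C d a * P) = a * res P := coeff_C_mul a P (-1)

theorem res_eq_zero {N : ℤ} {P : Op d} (h : OrdLE N P) (hN : N < -1) : res P = 0 :=
  h (-1) hN

/-- The residue is the D⁰ coefficient of P f. A term p_j D^j f reaches D⁰ only through its j-th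
derivative with binomial (j choose j), and never when j < 0. Expressing the action as a residue
allows it to be manipulated inside the operator ring. -/
theorem plusApply_eq_res (P : Op d) (f : A) :
    plusApply d P f = res (P * C d f * D d (-1)) := by
  rw [res_apply, coeff_mul_D]
  obtain ⟨N, hN⟩ := P.exists_ordLE
  have hN' : OrderLE (N.toNat : ℤ) P := hN.mono (by omega)
  have h := coeff_mul_monomial d hN' 0 f N.toNat
  have e : (-1 - -1 : ℤ) = N.toNat + 0 - N.toNat := by ring
  rw [e]
  refine Eq.trans ?_ h.symm
  unfold plusApply
  rw [finsum_eq_sum_of_support_subset (s := range (N.toNat + 1)),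
    Nat.sum_antidiagonal_eq_sum_range_succ_mk]
  · refine sum_congr rfl fun m hm => ?_
    rw [mem_range] at hm
    simp only [plus]
    rw [if_pos (by omega), show (N.toNat : ℤ) - ((N.toNat - m : ℕ) : ℤ) = m by omega,
      Ring.choose_natCast, Nat.choose_self]
    simp
  · intro m hm
    rw [mem_coe, mem_range]
    by_contra h
    refine hm ?_
    simp only [plus]
    rw [if_pos (by omega), hN' _ (by omega), zero_mul]

/-- P* f D⁻¹ is minus the adjoint of D⁻¹ f P, and the residue changes sign under the adjoint, so the
two signs cancel. -/
theorem plusApply_adj_eq_res (P : Op d) (f : A) :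
    plusApply d (adj d P) f = res (D d (-1) * C d f * P) := by
  rw [plusApply_eq_res]
  have : adj d P * C d f * D d (-1) = -adj d (D d (-1) * C d f * P) := by
    rw [adj_mul, adj_mul, adj_C, adj_D]
    simp [mul_assoc]
  rw [this, map_neg, res_adj, neg_neg]

variable (d) in
/-- The differential part as an additive map. -/
noncomputable def plus : Op d →+ Op d where
  toFun P := PDO.plus P
  map_zero' := ext fun k => ite_self _
  map_add' P Q := ext fun k => by
    change (if 0 ≤ k then (P + Q).coeff k else 0) =
      (if 0 ≤ k then P.coeff k else 0) + (if 0 ≤ k then Q.coeff k else 0)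
    split_ifs <;> simp

theorem coeff_plus (P : Op d) (k : ℤ) :
    (plus d P).coeff k = if 0 ≤ k then P.coeff k else 0 := rfl

theorem ordLE_sub_plus (P : Op d) : OrdLE (-1) (P - plus d P) := by
  intro k hk
  rw [coeff_sub, coeff_plus, if_pos (by omega), sub_self]

/-- Differential operators: no negative powers of `D`. -/
def IsDifferential (P : Op d) : Prop := ∀ k : ℤ, k < 0 → P.coeff k = 0

theorem isDifferential_plus (P : Op d) : IsDifferential (plus d P) := fun k hk => by
  rw [coeff_plus, if_neg (by omega)]

theorem isDifferential_C (a : A) : IsDifferential (C d a) := fun k hk => by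
  rw [coeff_C, if_neg (by omega)]

theorem isDifferential_D (j : ℕ) : IsDifferential (D d j) := fun k hk => by
  rw [coeff_D, if_neg (by omega)]

theorem isDifferential_zero : IsDifferential (0 : Op d) := fun _ _ => rfl

theorem IsDifferential.add {P Q : Op d} (hP : IsDifferential P) (hQ : IsDifferential Q) :
    IsDifferential (P + Q) := fun k hk => by rw [coeff_add, hP k hk, hQ k hk, add_zero]

theorem IsDifferential.neg {P : Op d} (hP : IsDifferential P) :
    IsDifferential (-P) := fun k hk => by rw [coeff_neg, hP k hk, neg_zero]

theorem IsDifferential.sum {ι : Type*} {s : Finset ι} {f : ι → Op d}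
    (h : ∀ i ∈ s, IsDifferential (f i)) : IsDifferential (∑ i ∈ s, f i) := fun k hk => by
  rw [coeff_sum]; exact Finset.sum_eq_zero fun i hi => h i hi k hk

/-- For i ≥ 0 the expansion of D^i f stops at D⁰, since (i choose m) = 0 for m > i. -/
theorem IsDifferential.mul {P Q : Op d} (hP : IsDifferential P) (hQ : IsDifferential Q) :
    IsDifferential (P * Q) := by
  intro k hk
  change (PDO.mul d P Q).coeff k = 0
  simp only [PDO.mul]
  rw [← finsum_zero (α := ℤ × ℕ)]
  refine finsum_congr fun x => ?_
  by_cases h1 : x.1 < 0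
  · rw [show PDO.coeff P x.1 = 0 from hP _ h1, zero_mul, smul_zero]
  by_cases h2 : k - x.1 + x.2 < 0
  · rw [show PDO.coeff Q _ = 0 from hQ _ h2, iterate_zero, mul_zero, smul_zero]
  · obtain ⟨i, hi⟩ := Int.eq_ofNat_of_zero_le (not_lt.mp h1)
    rw [hi, Ring.choose_natCast, Nat.choose_eq_zero_of_lt (by omega)]
    simp

theorem IsDifferential.res_eq_zero {P : Op d} (hP : IsDifferential P) : res P = 0 :=
  hP (-1) (by omega)

/-- The coefficientwise action of a derivation. -/
noncomputable def der (δ : Derivation ℚ A A) : Op d →+ Op d where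
  toFun P := (⟨fun k => δ (P.coeff k), by
    obtain ⟨N, hN⟩ := P.exists_ordLE
    exact ⟨N, fun k hk => by rw [hN k hk, map_zero]⟩⟩ : PDO A)
  map_zero' := ext fun k => map_zero δ
  map_add' P Q := ext fun k => map_add δ _ _

theorem coeff_der (δ : Derivation ℚ A A) (P : Op d) (k : ℤ) :
    (der δ P).coeff k = δ (P.coeff k) := rfl

theorem OrdLE.der {N : ℤ} {P : Op d} (h : OrdLE N P) (δ : Derivation ℚ A A) :
    OrdLE N (der δ P) := fun k hk => by rw [coeff_der, h k hk, map_zero]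

theorem der_C (δ : Derivation ℚ A A) (a : A) : der δ (C d a) = C d (δ a) := by
  ext k
  rw [coeff_der, coeff_C, coeff_C]
  split_ifs <;> simp

theorem der_D (δ : Derivation ℚ A A) (j : ℤ) : der δ (D d j) = 0 := by
  ext k
  rw [coeff_der, coeff_D, coeff_zero]
  split_ifs <;> simp

theorem der_mul {δ : Derivation ℚ A A} (hδ : ∀ f, δ (d f) = d (δ f)) (P Q : Op d) :
    der δ (P * Q) = der δ P * Q + P * der δ Q :=
  ext fun k => derivation_coeff_mul hδ (P := P) (Q := Q) (fun _ => rfl) (fun _ => rfl) k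

end Op

end PDO

end KP

/-! ### The operator ε d/dε + ∑ ε^l δ_l on power series, and its kernel. -/

namespace KP

open Finset

section EulerD

variable {B : Type*} [Ring B]

/-- The operator `F ↦ ε dF/dε + ∑_l ε^l δ_l F` on formal power series in `ε`. -/
noncomputable def eulerD (δ : ℕ → B →+ B) : PowerSeries B →+ PowerSeries B :=
  AddMonoidHom.mk' (fun F => PowerSeries.mk fun n => n • PowerSeries.coeff n F +
      ∑ x ∈ antidiagonal n, δ x.1 (PowerSeries.coeff x.2 F)) fun F G => by
    ext n
    simp only [PowerSeries.coeff_mk, map_add, smul_add, sum_add_distrib]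
    abel

variable {δ : ℕ → B →+ B}

theorem coeff_eulerD (δ : ℕ → B →+ B) (F : PowerSeries B) (n : ℕ) :
    PowerSeries.coeff n (eulerD δ F) = n • PowerSeries.coeff n F +
      ∑ x ∈ antidiagonal n, δ x.1 (PowerSeries.coeff x.2 F) := by
  simp [eulerD]

theorem eulerD_mul (hδ : ∀ l a b, δ l (a * b) = δ l a * b + a * δ l b) (F G : PowerSeries B) :
    eulerD δ (F * G) = eulerD δ F * G + F * eulerD δ G := by
  ext n
  rw [map_add, coeff_eulerD, PowerSeries.coeff_mul, PowerSeries.coeff_mul, PowerSeries.coeff_mul]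
  simp only [coeff_eulerD, PowerSeries.coeff_mul, map_sum, hδ, sum_add_distrib, add_mul, mul_add,
    sum_mul, mul_sum]
  have h1 : n • ∑ x ∈ antidiagonal n, PowerSeries.coeff x.1 F * PowerSeries.coeff x.2 G =
      ∑ x ∈ antidiagonal n, x.1 • PowerSeries.coeff x.1 F * PowerSeries.coeff x.2 G +
      ∑ x ∈ antidiagonal n, PowerSeries.coeff x.1 F * x.2 • PowerSeries.coeff x.2 G := by
    rw [smul_sum, ← sum_add_distrib]
    refine sum_congr rfl fun x hx => ?_
    rw [HasAntidiagonal.mem_antidiagonal] at hx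
    rw [smul_mul_assoc, mul_smul_comm, ← add_smul, hx]
  have h2 : ∑ x ∈ antidiagonal n, ∑ y ∈ antidiagonal x.2,
      δ x.1 (PowerSeries.coeff y.1 F) * PowerSeries.coeff y.2 G =
      ∑ x ∈ antidiagonal n, ∑ y ∈ antidiagonal x.1,
        δ y.1 (PowerSeries.coeff y.2 F) * PowerSeries.coeff x.2 G :=
    (sum_antidiagonal_assoc n
      (fun p q r => δ p (PowerSeries.coeff q F) * PowerSeries.coeff r G)).symm
  have h3 : ∑ x ∈ antidiagonal n, ∑ y ∈ antidiagonal x.2,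
      PowerSeries.coeff y.1 F * δ x.1 (PowerSeries.coeff y.2 G) =
      ∑ x ∈ antidiagonal n, ∑ y ∈ antidiagonal x.2,
        PowerSeries.coeff x.1 F * δ y.1 (PowerSeries.coeff y.2 G) := by
    rw [← sum_antidiagonal_assoc n
        (fun p q r => PowerSeries.coeff q F * δ p (PowerSeries.coeff r G)),
      ← sum_antidiagonal_assoc n
        (fun p q r => PowerSeries.coeff p F * δ q (PowerSeries.coeff r G))]
    refine sum_congr rfl fun x _ => ?_
    exact (Nat.sum_antidiagonal_swap (n := x.1)
      (f := fun y => PowerSeries.coeff y.1 F * δ y.2 (PowerSeries.coeff x.2 G)))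
  rw [h1, h2, h3]
  abel

theorem eulerD_X_mul (F : PowerSeries B) :
    eulerD δ (PowerSeries.X * F) = PowerSeries.X * F + PowerSeries.X * eulerD δ F := by
  ext n
  rcases n with _ | n
  · simp [coeff_eulerD]
  · rw [map_add, coeff_eulerD, PowerSeries.coeff_succ_X_mul, PowerSeries.coeff_succ_X_mul,
      coeff_eulerD, Nat.sum_antidiagonal_succ', PowerSeries.coeff_zero_X_mul, map_zero]
    simp only [PowerSeries.coeff_succ_X_mul, succ_nsmul]
    abel

theorem coeff_eulerD_C (a : B) (n : ℕ) : PowerSeries.coeff n (eulerD δ (PowerSeries.C a)) =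
    δ n a := by
  rw [coeff_eulerD, sum_eq_single (n, 0)]
  · rcases n with _ | n <;> simp [PowerSeries.coeff_C]
  · rintro ⟨p, q⟩ hx hne
    rw [HasAntidiagonal.mem_antidiagonal] at hx
    have : q ≠ 0 := by rintro rfl; simp at hx; exact hne (by rw [hx])
    simp [PowerSeries.coeff_C, this]
  · simp

theorem eulerD_one (hδ : ∀ l a b, δ l (a * b) = δ l a * b + a * δ l b) : eulerD δ 1 = 0 := by
  have := eulerD_mul hδ 1 1
  rw [mul_one, one_mul, mul_one] at this
  simpa using this

/-- Since δ_0 = 0, the operator is triangular: apart from the diagonal term n, the n-th coefficient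
of the image involves only lower coefficients. All the uniqueness arguments rest on this. -/
theorem coeff_eulerD_of_forall_lt (h0 : δ 0 = 0) {F : PowerSeries B} {n : ℕ}
    (h : ∀ i < n, PowerSeries.coeff i F = 0) :
    PowerSeries.coeff n (eulerD δ F) = n • PowerSeries.coeff n F := by
  rw [coeff_eulerD, sum_eq_zero, add_zero]
  rintro ⟨p, q⟩ hx
  rw [HasAntidiagonal.mem_antidiagonal] at hx
  by_cases hp : p = 0
  · simp [hp, h0]
  · rw [h q (by simp at hx; omega), map_zero]

theorem eq_zero_of_nsmul_eq_zero [Algebra ℚ B] {n : ℕ} (hn : n ≠ 0) {a : B} (h : n • a = 0) :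
    a = 0 := by
  have h1 : ((n : ℚ)⁻¹ * n) • a = 0 := by
    rw [mul_smul, Nat.cast_smul_eq_nsmul, h, smul_zero]
  rwa [inv_mul_cancel₀ (by exact_mod_cast hn), one_smul] at h1

theorem eq_zero_of_eulerD_eq_zero [Algebra ℚ B] (h0 : δ 0 = 0) {F : PowerSeries B}
    (hF0 : PowerSeries.coeff 0 F = 0) (hF : eulerD δ F = 0) : F = 0 := by
  ext n
  rw [map_zero]
  induction n using Nat.strong_induction_on with
  | _ n ih =>
    rcases Nat.eq_zero_or_pos n with rfl | hn
    · exact hF0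
    · have := coeff_eulerD_of_forall_lt h0 ih
      rw [hF, map_zero] at this
      exact eq_zero_of_nsmul_eq_zero (by omega) this.symm

/-- The coefficientwise action of an additive map on power series. -/
noncomputable def coeffwise {B B' : Type*} [Ring B] [Ring B'] (f : B →+ B') :
    PowerSeries B →+ PowerSeries B' :=
  AddMonoidHom.mk' (fun F => PowerSeries.mk fun n => f (PowerSeries.coeff n F)) fun F G => by
    ext n; simp

@[simp] theorem coeff_coeffwise {B' : Type*} [Ring B'] (f : B →+ B') (F : PowerSeries B) (n : ℕ) :
    PowerSeries.coeff n (coeffwise f F) = f (PowerSeries.coeff n F) := by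
  simp [coeffwise]

theorem coeffwise_X_mul {B' : Type*} [Ring B'] (f : B →+ B') (F : PowerSeries B) :
    coeffwise f (PowerSeries.X * F) = PowerSeries.X * coeffwise f F := by
  ext n
  rcases n with _ | n
  · simp
  · simp [PowerSeries.coeff_succ_X_mul]

theorem eulerD_coeffwise {B' : Type*} [Ring B'] {δ' : ℕ → B' →+ B'} (f : B →+ B')
    (hf : ∀ l a, δ' l (f a) = f (δ l a)) (F : PowerSeries B) :
    eulerD δ' (coeffwise f F) = coeffwise f (eulerD δ F) := by
  ext n
  simp only [coeff_eulerD, coeff_coeffwise, hf, map_add, map_nsmul, map_sum]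

end EulerD

/-! ### Leading coefficients, the Lax equation for the root, and series of operators. -/

namespace PDO

namespace Op

variable {A : Type*} [CommRing A] [Algebra ℚ A] {d : Derivation ℚ A A}

theorem coeff_mul_add {P Q : Op d} {N M : ℤ} (hP : OrdLE N P) (hQ : OrdLE M Q) :
    (P * Q).coeff (N + M) = P.coeff N * Q.coeff M := by
  change (PDO.mul d P Q).coeff (N + M) = _
  simp only [PDO.mul]
  rw [finsum_eq_single _ (N, 0)]
  · simp only [Ring.choose_zero_right, one_smul, Function.iterate_zero, id, Nat.cast_zero, add_zero,
      add_sub_cancel_left]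
    rfl
  · intro x hx
    refine mul_term_eq_zero d hP hQ _ x fun h => hx ?_
    ext
    · simp only; omega
    · simp only; omega

theorem ordLE_one : OrdLE 0 (1 : Op d) := ordLE_D 0

theorem OrdLE.pow {Q : Op d} (hQ : OrdLE 1 Q) (n : ℕ) : OrdLE n (Q ^ n) := by
  induction n with
  | zero => rw [pow_zero]; exact ordLE_one
  | succ n ih => rw [pow_succ]; exact (ih.mul hQ).mono (by push_cast; omega)

theorem coeff_pow_self {Q : Op d} (hQ : OrdLE 1 Q) (h1 : Q.coeff 1 = 1) (n : ℕ) :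
    (Q ^ n).coeff n = 1 := by
  induction n with
  | zero => rw [pow_zero]; rfl
  | succ n ih =>
    rw [pow_succ, Nat.cast_succ, coeff_mul_add (OrdLE.pow hQ n) hQ, ih, h1, one_mul]

/-- A derivation that kills a positive power of a monic operator of order one kills it. -/
theorem eq_zero_of_map_pow_eq_zero (δ : Op d →+ Op d)
    (hδ : ∀ P P', δ (P * P') = δ P * P' + P * δ P') {Q : Op d} (hQ : OrdLE 1 Q)
    (h1 : Q.coeff 1 = 1) {r : ℕ} (hr : 1 ≤ r) (h : δ (Q ^ r) = 0) : δ Q = 0 := by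
  have step : ∀ m : ℤ, OrdLE m (δ Q) → OrdLE (m - 1) (δ Q) := by
    intro m hm
    -- As Q is monic of order one, each factor of Q^(s+1) contributes the same top coefficient, that
    -- of D^m in δQ. At s + 1 = r the total is zero, and r is invertible over ℚ, so the order of δQ
    -- drops below m.
    have key : ∀ s : ℕ, OrdLE (m + s) (δ (Q ^ (s + 1))) ∧
        (δ (Q ^ (s + 1))).coeff (m + s) = (s + 1) • (δ Q).coeff m := by
      intro s
      induction s with
      | zero => simpa using hm
      | succ s ih =>
        have a1 : OrdLE (m + s + 1) (δ (Q ^ (s + 1)) * Q) := ih.1.mul hQ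
        have a2 : OrdLE (((s + 1 : ℕ) : ℤ) + m) (Q ^ (s + 1) * δ Q) := (OrdLE.pow hQ _).mul hm
        have e : m + ((s + 1 : ℕ) : ℤ) = m + s + 1 := by push_cast; ring
        rw [pow_succ, hδ]
        refine ⟨(a1.mono (by omega)).add (a2.mono (by omega)), ?_⟩
        rw [coeff_add, e, coeff_mul_add ih.1 hQ, ← e,
          add_comm m ((s + 1 : ℕ) : ℤ),
          coeff_mul_add (OrdLE.pow hQ (s + 1)) hm, ih.2, h1, coeff_pow_self hQ h1, mul_one, one_mul,
          succ_nsmul _ (s + 1)]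
    intro k hk
    rcases eq_or_lt_of_le (show m ≤ k by omega) with rfl | hk'
    · have := (key (r - 1)).2
      rw [Nat.sub_add_cancel hr, h, coeff_zero] at this
      exact eq_zero_of_nsmul_eq_zero (by omega) this.symm
    · exact hm k hk'
  obtain ⟨N, hN⟩ := (δ Q).exists_ordLE
  have all : ∀ n : ℕ, OrdLE (N - n) (δ Q) := by
    intro n
    induction n with
    | zero => simpa using hN
    | succ n ih => exact (step _ ih).mono (by push_cast; omega)
  exact eq_zero_of_ordLE fun M => (all (N - M).toNat).mono (by omega)

/-- The Lax equation for a power of `Q` implies the Lax equation for `Q`. -/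
theorem der_eq_commutator_of_pow {δ : Derivation ℚ A A} (hδ : ∀ f, δ (d f) = d (δ f))
    {Q : Op d} (hQ : OrdLE 1 Q) (h1 : Q.coeff 1 = 1) {r : ℕ} (hr : 1 ≤ r) (B : Op d)
    (h : der δ (Q ^ r) = B * Q ^ r - Q ^ r * B) : der δ Q = B * Q - Q * B := by
  -- The map der δ - [B, ·] is a derivation of the operator ring, and the hypothesis says that it
  -- kills Q^r.
  refine sub_eq_zero.mp (eq_zero_of_map_pow_eq_zero
    (der δ - (AddMonoidHom.mulLeft B - AddMonoidHom.mulRight B)) ?_ hQ h1 hr (sub_eq_zero.mpr h))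
  intro P P'
  change der δ (P * P') - (B * (P * P') - P * P' * B) =
    (der δ P - (B * P - P * B)) * P' + P * (der δ P' - (B * P' - P' * B))
  rw [der_mul hδ]
  noncomm_ring

/-- All coefficients of the series have order at most `N`. -/
def SOrdLE (N : ℤ) (F : PowerSeries (Op d)) : Prop := ∀ n, OrdLE N (PowerSeries.coeff n F)

theorem SOrdLE.mono {N M : ℤ} {F : PowerSeries (Op d)} (h : SOrdLE N F) (hNM : N ≤ M) :
    SOrdLE M F := fun n => (h n).mono hNM

theorem SOrdLE.add {N : ℤ} {F G : PowerSeries (Op d)} (hF : SOrdLE N F) (hG : SOrdLE N G) :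
    SOrdLE N (F + G) := fun n => by rw [map_add]; exact (hF n).add (hG n)

theorem SOrdLE.sub {N : ℤ} {F G : PowerSeries (Op d)} (hF : SOrdLE N F) (hG : SOrdLE N G) :
    SOrdLE N (F - G) := fun n => by rw [map_sub]; exact (hF n).sub (hG n)

theorem SOrdLE.mul {N M : ℤ} {F G : PowerSeries (Op d)} (hF : SOrdLE N F) (hG : SOrdLE M G) :
    SOrdLE (N + M) (F * G) := fun n => by
  rw [PowerSeries.coeff_mul]; exact OrdLE.sum fun x _ => (hF _).mul (hG _)

theorem sOrdLE_C {N : ℤ} {P : Op d} (h : OrdLE N P) : SOrdLE N (PowerSeries.C P) := fun n => by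
  rw [PowerSeries.coeff_C]; split_ifs
  exacts [h, ordLE_zero N]

theorem sOrdLE_X : SOrdLE 0 (PowerSeries.X : PowerSeries (Op d)) := fun n => by
  rw [PowerSeries.coeff_X]; split_ifs
  exacts [ordLE_one, ordLE_zero 0]

theorem sOrdLE_map (a : PowerSeries A) : SOrdLE 0 (PowerSeries.map (C d) a) := fun n => by
  rw [PowerSeries.coeff_map]; exact ordLE_C _

/-- All coefficients of the series are differential operators. -/
def SDifferential (F : PowerSeries (Op d)) : Prop := ∀ n, IsDifferential (PowerSeries.coeff n F)

theorem SDifferential.add {F G : PowerSeries (Op d)} (hF : SDifferential F)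
    (hG : SDifferential G) : SDifferential (F + G) := fun n => by
  rw [map_add]; exact (hF n).add (hG n)

theorem SDifferential.sub {F G : PowerSeries (Op d)} (hF : SDifferential F)
    (hG : SDifferential G) : SDifferential (F - G) := fun n => by
  rw [map_sub, sub_eq_add_neg]; exact (hF n).add (hG n).neg

theorem SDifferential.mul {F G : PowerSeries (Op d)} (hF : SDifferential F)
    (hG : SDifferential G) : SDifferential (F * G) := fun n => by
  rw [PowerSeries.coeff_mul]; exact IsDifferential.sum fun x _ => (hF _).mul (hG _)

theorem sDifferential_C {P : Op d} (h : IsDifferential P) : SDifferential (PowerSeries.C P) :=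
  fun n => by
    rw [PowerSeries.coeff_C]; split_ifs
    exacts [h, isDifferential_zero]

theorem sDifferential_X : SDifferential (PowerSeries.X : PowerSeries (Op d)) := fun n => by
  rw [PowerSeries.coeff_X]; split_ifs
  exacts [isDifferential_D 0, isDifferential_zero]

theorem sDifferential_map (a : PowerSeries A) : SDifferential (PowerSeries.map (C d) a) :=
  fun n => by rw [PowerSeries.coeff_map]; exact isDifferential_C _

/-- This replaces projection onto differential parts: an identity between differential series need
only be checked modulo order -1. -/
theorem eq_zero_of_sDifferential {F : PowerSeries (Op d)} (hF : SDifferential F)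
    (hF' : SOrdLE (-1) F) : F = 0 := by
  ext n k
  rw [map_zero, coeff_zero]
  by_cases hk : k < 0
  · exact hF n k hk
  · exact hF' n k (by omega)

end Op

end PDO

end KP

/-! ### Dressing: the normal form V(1 - εQ) = 1 + c - εD. -/

namespace KP

open Finset PDO

namespace PDO.Op

variable {A : Type*} [CommRing A] [Algebra ℚ A] {d : Derivation ℚ A A}

/-- The geometric series `(1 - ε Q)⁻¹ = ∑ ε^n Q^n`. -/
noncomputable def geom (Q : Op d) : PowerSeries (Op d) := PowerSeries.mk fun n => Q ^ n

/-- The series `∑ ε^n (Q^n)_+`. -/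
noncomputable def geomPlus (Q : Op d) : PowerSeries (Op d) := coeffwise (plus d) (geom Q)

/-- The series `∑ ε^n Res Q^n`. -/
noncomputable def geomRes (Q : Op d) : PowerSeries A := coeffwise res (geom Q)

theorem coeff_geom (Q : Op d) (n : ℕ) : PowerSeries.coeff n (geom Q) = Q ^ n :=
  PowerSeries.coeff_mk _ _

theorem coeff_geomPlus (Q : Op d) (n : ℕ) : PowerSeries.coeff n (geomPlus Q) = plus d (Q ^ n) := by
  rw [geomPlus, coeff_coeffwise, coeff_geom]

theorem coeff_X_mul_C_mul (Q : Op d) (F : PowerSeries (Op d)) (n : ℕ) :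
    PowerSeries.coeff (n + 1) (PowerSeries.X * PowerSeries.C Q * F) =
      Q * PowerSeries.coeff n F := by
  rw [mul_assoc, PowerSeries.coeff_succ_X_mul, PowerSeries.coeff_C_mul]

theorem coeff_mul_X_mul_C (Q : Op d) (F : PowerSeries (Op d)) (n : ℕ) :
    PowerSeries.coeff (n + 1) (F * (PowerSeries.X * PowerSeries.C Q)) =
      PowerSeries.coeff n F * Q := by
  rw [← mul_assoc, PowerSeries.coeff_mul_C, PowerSeries.coeff_succ_mul_X]

theorem sub_mul_geom (Q : Op d) : (1 - PowerSeries.X * PowerSeries.C Q) * geom Q = 1 := by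
  ext1 n
  rw [sub_mul, one_mul, map_sub]
  rcases n with _ | n
  · rw [mul_assoc]; simp [coeff_geom]
  · rw [coeff_X_mul_C_mul, coeff_geom, coeff_geom, pow_succ', sub_self, PowerSeries.coeff_one,
      if_neg (by omega)]

theorem geom_mul_sub (Q : Op d) : geom Q * (1 - PowerSeries.X * PowerSeries.C Q) = 1 := by
  ext1 n
  rw [mul_sub, mul_one, map_sub]
  rcases n with _ | n
  · rw [← mul_assoc]; simp [coeff_geom]
  · rw [coeff_mul_X_mul_C, coeff_geom, coeff_geom, pow_succ, sub_self, PowerSeries.coeff_one,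
      if_neg (by omega)]

/-- The coefficients of the series `V = 1 + O(D⁻¹)` such that `V (1 - ε Q)` has order one in `D`. -/
noncomputable def dress (Q : Op d) : ℕ → Op d
  | 0 => 1
  | 1 => Q - D d 1 - C d (Q.coeff 0)
  | n + 2 => dress Q (n + 1) * Q - C d ((dress Q (n + 1) * Q).coeff 0)

/-- The coefficients of the function `c` with `V (1 - ε Q) = 1 + c - ε D`. -/
noncomputable def dressCoeff (Q : Op d) : ℕ → A
  | 0 => 0
  | 1 => -Q.coeff 0
  | n + 2 => -(dress Q (n + 1) * Q).coeff 0

/-- The series `V`. -/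
noncomputable def dressSeries (Q : Op d) : PowerSeries (Op d) := PowerSeries.mk (dress Q)

/-- The function `c`. -/
noncomputable def dressFun (Q : Op d) : PowerSeries A := PowerSeries.mk (dressCoeff Q)

/-- The series `G = 1 + c - ε D`, whose action on eigenfunctions is the Miwa shift. -/
noncomputable def miwaOp (Q : Op d) : PowerSeries (Op d) :=
  1 + PowerSeries.map (C d) (dressFun Q) - PowerSeries.X * PowerSeries.C (D d 1)

/-- The recursion is forced: the ε^(n+1) coefficient of V(1-εQ) is V_(n+1) - V_n Q, so V_(n+1) is
V_n Q with its D⁰ coefficient removed, and what is removed defines c. For n = 0 the leading D of Q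
must be removed too; it becomes the term -εD. -/
theorem dressSeries_mul (Q : Op d) :
    dressSeries Q * (1 - PowerSeries.X * PowerSeries.C Q) = miwaOp Q := by
  ext1 n
  rw [mul_sub, mul_one, map_sub, miwaOp, map_sub, map_add, PowerSeries.coeff_map]
  rcases n with _ | _ | n
  · rw [← mul_assoc]
    simp [dressSeries, dressFun, dress, dressCoeff]
  · rw [coeff_mul_X_mul_C, PowerSeries.coeff_succ_X_mul]
    simp only [dressSeries, dressFun, PowerSeries.coeff_mk, dress, dressCoeff,
      PowerSeries.coeff_one, PowerSeries.coeff_C, map_neg, if_true]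
    rw [if_neg (by omega), one_mul]
    abel
  · rw [coeff_mul_X_mul_C, PowerSeries.coeff_succ_X_mul]
    simp only [dressSeries, dressFun, PowerSeries.coeff_mk, dress, dressCoeff,
      PowerSeries.coeff_one, PowerSeries.coeff_C, map_neg]
    rw [if_neg (by omega), if_neg (by omega)]
    abel

/-- If V_n has order at most -1, then V_n Q has order at most 0, and the subtraction removes
precisely its D⁰ coefficient. -/
theorem ordLE_dress {Q : Op d} (hQ : OrdLE 1 Q) (h1 : Q.coeff 1 = 1) (n : ℕ) :
    OrdLE (-1) (dress Q (n + 1)) := by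
  induction n with
  | zero =>
    intro k hk
    simp only [dress, coeff_sub, coeff_D, coeff_C]
    rcases lt_trichotomy k 1 with h | rfl | h
    · obtain rfl : k = 0 := by omega
      simp
    · simp [h1]
    · rw [hQ k h, if_neg (by omega), if_neg (by omega)]; simp
  | succ n ih =>
    intro k hk
    simp only [dress, coeff_sub, coeff_C]
    rcases eq_or_ne k 0 with rfl | h
    · simp
    · rw [(ih.mul hQ) k (by omega), if_neg h, sub_zero]

theorem sOrdLE_dressSeries_sub_one {Q : Op d} (hQ : OrdLE 1 Q) (h1 : Q.coeff 1 = 1) :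
    SOrdLE (-1) (dressSeries Q - 1) := by
  intro n
  rw [map_sub, dressSeries, PowerSeries.coeff_mk, PowerSeries.coeff_one]
  rcases n with _ | n
  · simp only [dress, if_true, sub_self]; exact ordLE_zero _
  · rw [if_neg (by omega), sub_zero]; exact ordLE_dress hQ h1 n

theorem sOrdLE_one : SOrdLE 0 (1 : PowerSeries (Op d)) := by
  simpa using sOrdLE_C (d := d) (N := 0) ordLE_one

theorem sOrdLE_geom_sub_geomPlus (Q : Op d) : SOrdLE (-1) (geom Q - geomPlus Q) := fun n => by
  rw [map_sub, coeff_geom, coeff_geomPlus]; exact ordLE_sub_plus _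

theorem sDifferential_geomPlus (Q : Op d) : SDifferential (geomPlus Q) := fun n => by
  rw [coeff_geomPlus]; exact isDifferential_plus _

theorem sDifferential_one : SDifferential (1 : PowerSeries (Op d)) := fun n => by
  rw [PowerSeries.coeff_one]; split_ifs
  exacts [isDifferential_D 0, isDifferential_zero]

theorem ordLE_D_mul_sub_res {Y : Op d} (hY : OrdLE (-1) Y) :
    OrdLE (-1) (D d 1 * Y - C d (res Y)) := by
  intro k hk
  rw [coeff_sub, coeff_C]
  rcases eq_or_ne k 0 with rfl | h
  · have := coeff_mul_add (ordLE_D 1) hY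
    rw [show (1 : ℤ) + -1 = 0 by ring] at this
    rw [this, coeff_D, if_pos rfl, if_pos rfl, one_mul, res_apply, sub_self]
  · rw [((ordLE_D 1).mul hY) k (by omega), if_neg h, sub_zero]

/-- Multiplying V(1-εQ) = G by the geometric series gives G(B + Y) = V, where Y collects the
negative parts of the powers of Q. Both sides of the claim are differential, V is 1 modulo order -1,
and the only contribution of GY in order 0 is -ε Res Y, coming from -εDY. -/
theorem miwaOp_mul_geomPlus {Q : Op d} (hQ : OrdLE 1 Q) (h1 : Q.coeff 1 = 1) :
    miwaOp Q * geomPlus Q = 1 + PowerSeries.X * PowerSeries.map (C d) (geomRes Q) := by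
  refine sub_eq_zero.mp (eq_zero_of_sDifferential ?_ ?_)
  · refine SDifferential.sub (SDifferential.mul ?_ (sDifferential_geomPlus Q))
      (sDifferential_one.add (sDifferential_X.mul (sDifferential_map _)))
    exact (sDifferential_one.add (sDifferential_map _)).sub
      (sDifferential_X.mul (sDifferential_C (isDifferential_D 1)))
  · have hV : miwaOp Q * geom Q = dressSeries Q := by
      rw [← dressSeries_mul, mul_assoc, sub_mul_geom, mul_one]
    set Y := geom Q - geomPlus Q with hY
    have e : miwaOp Q * geomPlus Q - (1 + PowerSeries.X * PowerSeries.map (C d) (geomRes Q)) =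
        (dressSeries Q - 1) - Y - PowerSeries.map (C d) (dressFun Q) * Y +
        PowerSeries.X * (PowerSeries.C (D d 1) * Y - PowerSeries.map (C d) (geomRes Q)) := by
      rw [← hV, show geom Q = geomPlus Q + Y by rw [hY]; abel, miwaOp]
      noncomm_ring
    rw [e]
    have hYo : SOrdLE (-1) Y := sOrdLE_geom_sub_geomPlus Q
    refine (((sOrdLE_dressSeries_sub_one hQ h1).sub hYo).sub
      (((sOrdLE_map _).mul hYo).mono (by omega))).add ((sOrdLE_X.mul fun n => ?_).mono
        (show 0 + -1 ≤ -1 by omega))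
    rw [map_sub, PowerSeries.coeff_C_mul, PowerSeries.coeff_map, geomRes, coeff_coeffwise]
    -- The differential part has no residue, so Q^n and its negative part have the same one.
    have : res (PowerSeries.coeff n (geom Q)) = res (PowerSeries.coeff n Y) := by
      rw [hY, map_sub, map_sub, coeff_geomPlus, (isDifferential_plus _).res_eq_zero, sub_zero]
    rw [this]
    exact ordLE_D_mul_sub_res (hYo n)

/-- If a_n is the first nonzero coefficient of a, then the ε^n term of the product is a_n Q⁰ = a_n,
a function of order 0. -/
theorem eq_zero_of_map_mul_geom {Q : Op d} (a : PowerSeries A)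
    (h : SOrdLE (-1) (PowerSeries.map (C d) a * geom Q)) : a = 0 := by
  ext n
  rw [map_zero]
  induction n using Nat.strong_induction_on with
  | _ n ih =>
    have h0 := h n 0 (by omega)
    rw [PowerSeries.coeff_mul, sum_eq_single (n, 0)] at h0
    · simpa [coeff_geom, coeff_C] using h0
    · rintro ⟨p, q⟩ hx hne
      rw [HasAntidiagonal.mem_antidiagonal] at hx
      have : q ≠ 0 := by rintro rfl; simp at hx; exact hne (by rw [hx])
      rw [PowerSeries.coeff_map, ih p (by simp at hx; omega), map_zero, zero_mul]
    · simp

end PDO.Op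

/-! ### The flow operator on functions and operators; evolution of c. -/

section Flows

open PDO.Op

variable {A : Type*} [CommRing A] [Algebra ℚ A]

/-- The derivations `∂/∂t_l`, with the convention `∂/∂t_0 = 0`. -/
noncomputable def timeDer (pd : ℕ+ → Derivation ℚ A A) (l : ℕ) : Derivation ℚ A A :=
  if h : 0 < l then pd ⟨l, h⟩ else 0

/-- The operator `ε d/dε + ∑ ε^l ∂/∂t_l` on series of functions. -/
noncomputable def flow (pd : ℕ+ → Derivation ℚ A A) : PowerSeries A →+ PowerSeries A :=
  eulerD fun l => ((timeDer pd l : A →ₗ[ℚ] A) : A →+ A)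

/-- The operator `ε d/dε + ∑ ε^l ∂/∂t_l` on series of operators. -/
noncomputable def opFlow (pd : ℕ+ → Derivation ℚ A A) :
    PowerSeries (Op (pd 1)) →+ PowerSeries (Op (pd 1)) :=
  eulerD fun l => der (timeDer pd l)

variable {pd : ℕ+ → Derivation ℚ A A}

theorem timeDer_zero : timeDer pd 0 = 0 := dif_neg (by omega)

theorem timeDer_pos (n : ℕ+) : timeDer pd n = pd n := dif_pos n.pos

theorem timeDer_comm (hpd : ∀ (m n : ℕ+) (f : A), pd m (pd n f) = pd n (pd m f)) (l : ℕ)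
    (f : A) : timeDer pd l (pd 1 f) = pd 1 (timeDer pd l f) := by
  unfold timeDer
  split_ifs
  · exact hpd _ _ _
  · simp

theorem flow_mul (F G : PowerSeries A) : flow pd (F * G) = flow pd F * G + F * flow pd G :=
  eulerD_mul (fun l a b => by
    change timeDer pd l (a * b) = timeDer pd l a * b + a * timeDer pd l b
    rw [Derivation.leibniz, smul_eq_mul, smul_eq_mul]; ring) F G

theorem flow_X_mul (F : PowerSeries A) :
    flow pd (PowerSeries.X * F) = PowerSeries.X * F + PowerSeries.X * flow pd F := eulerD_X_mul F

theorem coeff_flow_C (a : A) (n : ℕ) :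
    PowerSeries.coeff n (flow pd (PowerSeries.C a)) = timeDer pd n a := coeff_eulerD_C a n

theorem flow_coeffwise (hpd : ∀ (m n : ℕ+) (f : A), pd m (pd n f) = pd n (pd m f))
    (F : PowerSeries A) : flow pd (coeffwise ((pd 1 : A →ₗ[ℚ] A) : A →+ A) F) =
      coeffwise ((pd 1 : A →ₗ[ℚ] A) : A →+ A) (flow pd F) :=
  eulerD_coeffwise _ (fun l a => timeDer_comm hpd l a) F

theorem eq_zero_of_flow_eq_zero {F : PowerSeries A}
    (hF0 : PowerSeries.coeff 0 F = 0) (hF : flow pd F = 0) : F = 0 :=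
  eq_zero_of_eulerD_eq_zero (by ext a; simp [timeDer_zero]) hF0 hF

theorem opFlow_mul (hpd : ∀ (m n : ℕ+) (f : A), pd m (pd n f) = pd n (pd m f))
    (F G : PowerSeries (Op (pd 1))) :
    opFlow pd (F * G) = opFlow pd F * G + F * opFlow pd G :=
  eulerD_mul (fun l a b => der_mul (timeDer_comm hpd l) a b) F G

theorem opFlow_one (hpd : ∀ (m n : ℕ+) (f : A), pd m (pd n f) = pd n (pd m f)) :
    opFlow pd 1 = 0 :=
  eulerD_one fun l a b => der_mul (timeDer_comm hpd l) a b

theorem opFlow_map (a : PowerSeries A) :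
    opFlow pd (PowerSeries.map (C (pd 1)) a) = PowerSeries.map (C (pd 1)) (flow pd a) := by
  have e : ∀ a : PowerSeries A, PowerSeries.map (C (pd 1)) a =
      coeffwise (C (pd 1) : A →+ Op (pd 1)) a := by
    intro a; ext1 n; simp
  rw [e, e]
  exact eulerD_coeffwise _ (fun l a => der_C _ a) a

theorem sOrdLE_opFlow {N : ℤ} {F : PowerSeries (Op (pd 1))} (h : SOrdLE N F) :
    SOrdLE N (opFlow pd F) := fun n => by
  rw [KP.opFlow, coeff_eulerD]
  refine OrdLE.add (fun k hk => ?_) (OrdLE.sum fun x _ => (h _).der _)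
  have := map_nsmul (PDO.Op.coeffHom (d := pd 1) k) n (PowerSeries.coeff n F)
  refine this.trans ?_
  change n • (PowerSeries.coeff n F).coeff k = 0
  rw [h n k hk, smul_zero]

variable {Q : Op (pd 1)}

/-- All Lax equations combine into one commutator with B = ∑ ε^n (Q^n)_+. The extra term n = 0 of B
is 1, which commutes with Q, in agreement with the convention ∂_0 = 0. -/
theorem opFlow_X_mul_C
    (hLax : ∀ n : ℕ+, der (pd n) Q = plus _ (Q ^ (n : ℕ)) * Q - Q * plus _ (Q ^ (n : ℕ))) :
    opFlow pd (PowerSeries.X * PowerSeries.C Q) = PowerSeries.X * PowerSeries.C Q +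
      PowerSeries.X * (geomPlus Q * PowerSeries.C Q - PowerSeries.C Q * geomPlus Q) := by
  rw [opFlow, eulerD_X_mul]
  congr 2
  ext1 n
  rw [coeff_eulerD_C, map_sub, PowerSeries.coeff_mul_C, PowerSeries.coeff_C_mul, coeff_geomPlus]
  rcases Nat.eq_zero_or_pos n with rfl | hn
  · have : plus (pd 1) 1 = 1 := Op.ext fun k => by
      rw [coeff_plus, ← D_zero, coeff_D]
      split_ifs <;> first | rfl | omega
    rw [timeDer_zero, pow_zero, this, one_mul, mul_one, sub_self]
    rfl
  · rw [show timeDer pd n = pd ⟨n, hn⟩ from dif_pos hn]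
    exact hLax ⟨n, hn⟩

/-- The evolution of the function `c`. -/
theorem flow_dressFun (hpd : ∀ (m n : ℕ+) (f : A), pd m (pd n f) = pd n (pd m f))
    (hQ : OrdLE 1 Q) (h1 : Q.coeff 1 = 1)
    (hLax : ∀ n : ℕ+, der (pd n) Q = plus _ (Q ^ (n : ℕ)) * Q - Q * plus _ (Q ^ (n : ℕ))) :
    flow pd (dressFun Q) = dressFun Q - PowerSeries.X * geomRes Q := by
  set V := dressSeries Q with hV
  set U := 1 - PowerSeries.X * PowerSeries.C Q with hU
  set Y := geom Q - geomPlus Q with hY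
  have hVU : V * U = miwaOp Q := dressSeries_mul Q
  -- With εQ = 1 - U, the commutator ε[B, Q] becomes UB - BU.
  have hUf : opFlow pd U = -(1 - U + U * geomPlus Q - geomPlus Q * U) := by
    rw [hU, map_sub, opFlow_one hpd, opFlow_X_mul_C hLax, mul_sub, ← mul_assoc, ← mul_assoc,
      PowerSeries.X_mul (φ := geomPlus Q)]
    noncomm_ring
  have hGf : opFlow pd (miwaOp Q) = PowerSeries.map (C (pd 1)) (flow pd (dressFun Q)) -
      PowerSeries.X * PowerSeries.C (D (pd 1) 1) := by
    have : opFlow pd (PowerSeries.C (D (pd 1) 1)) = 0 := by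
      ext1 n
      rw [opFlow, coeff_eulerD_C, der_D, map_zero]
    rw [miwaOp, map_sub, map_add, opFlow_one hpd, opFlow_map, zero_add, opFlow, eulerD_X_mul]
    rw [opFlow] at this
    rw [this, mul_zero, add_zero]
  have hprod := opFlow_mul hpd V U
  rw [hVU, hUf, hGf] at hprod
  have hGP := miwaOp_mul_geomPlus hQ h1
  rw [← hVU] at hGP
  have hGU : geom Q * U = 1 := geom_mul_sub Q
  -- Differentiate VU = G and eliminate VUB = GB by `miwaOp_mul_geomPlus`; the terms VBU are
  -- absorbed in VYU, since VYU = V - VBU.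
  have key : PowerSeries.map (C (pd 1)) (flow pd (dressFun Q) - dressFun Q +
      PowerSeries.X * geomRes Q) = (opFlow pd V - V * Y) * U := by
    have e1 : V * Y * U = V - V * geomPlus Q * U := by
      rw [hY, mul_sub V, sub_mul (V * geom Q), mul_assoc V, hGU, mul_one]
    have e2 : opFlow pd V * U = PowerSeries.map (C (pd 1)) (flow pd (dressFun Q)) -
        PowerSeries.X * PowerSeries.C (D (pd 1) 1) + (V - V * U + V * U * geomPlus Q -
          V * geomPlus Q * U) := by
      rw [hprod]; noncomm_ring
    rw [sub_mul, e1, e2, hGP, hVU, miwaOp, map_add, map_sub, map_mul, PowerSeries.map_X]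
    abel
  have hz : flow pd (dressFun Q) - dressFun Q + PowerSeries.X * geomRes Q = 0 := by
    refine eq_zero_of_map_mul_geom (Q := Q) _ ?_
    rw [key, mul_assoc, sub_mul_geom, mul_one]
    -- The flow kills the constant 1, so the flow of V has order at most -1, as does VY. After
    -- removing U on the right, a function times the geometric series has order at most -1 and must
    -- vanish.
    have h2 : opFlow pd V = opFlow pd (V - 1) := by rw [map_sub, opFlow_one hpd, sub_zero]
    have hV1 := sOrdLE_dressSeries_sub_one hQ h1
    have hV0 : SOrdLE 0 V := by
      have := (hV1.mono (show (-1 : ℤ) ≤ 0 by omega)).add (sOrdLE_one (d := pd 1))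
      rwa [sub_add_cancel] at this
    rw [h2]
    exact (sOrdLE_opFlow hV1).sub ((hV0.mul (sOrdLE_geom_sub_geomPlus Q)).mono (by omega))
  linear_combination hz

end Flows

end KP

/-! ### Exponentials of power series over a noncommutative ring. -/

namespace KP

open Finset

section Exp

variable {E : Type*} [Ring E]

theorem coeff_pow_eq_zero {θ : PowerSeries E} (h0 : PowerSeries.coeff 0 θ = 0) {n k : ℕ}
    (h : n < k) : PowerSeries.coeff n (θ ^ k) = 0 := by
  induction k generalizing n with
  | zero => omega
  | succ k ih =>
    rw [pow_succ, PowerSeries.coeff_mul]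
    refine sum_eq_zero fun x hx => ?_
    rw [HasAntidiagonal.mem_antidiagonal] at hx
    by_cases h2 : x.2 = 0
    · rw [h2, h0, mul_zero]
    · rw [ih (by omega), zero_mul]

/-- The operator `F ↦ ε dF/dε`. -/
noncomputable def euler (E : Type*) [Ring E] : PowerSeries E →+ PowerSeries E :=
  eulerD fun _ => 0

theorem coeff_euler (F : PowerSeries E) (n : ℕ) :
    PowerSeries.coeff n (euler E F) = n • PowerSeries.coeff n F := by
  simp [euler, coeff_eulerD]

theorem euler_mul (F G : PowerSeries E) : euler E (F * G) = euler E F * G + F * euler E G :=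
  eulerD_mul (fun l a b => by simp) F G

theorem euler_pow {θ : PowerSeries E} (h : Commute (euler E θ) θ) (k : ℕ) :
    euler E (θ ^ (k + 1)) = (k + 1) • (euler E θ * θ ^ k) := by
  induction k with
  | zero => simp
  | succ k ih =>
    rw [pow_succ, euler_mul, ih, ← (h.pow_right (k + 1)).eq, succ_nsmul _ (k + 1), pow_succ θ k,
      smul_mul_assoc, mul_assoc]

variable [Algebra ℚ E]

theorem coeff_expSeries {θ : PowerSeries E} (h0 : PowerSeries.coeff 0 θ = 0) {n N : ℕ}
    (h : n ≤ N) : PowerSeries.coeff n (expSeries θ) =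
      ∑ k ∈ range (N + 1), (1 / (k.factorial : ℚ)) • PowerSeries.coeff n (θ ^ k) := by
  rw [expSeries, PowerSeries.coeff_mk]
  refine sum_subset (by simpa using h) fun k _ hk => ?_
  rw [coeff_pow_eq_zero h0 (by simpa using hk), smul_zero]

theorem coeff_mul_expSeries {θ : PowerSeries E} (h0 : PowerSeries.coeff 0 θ = 0)
    (M : PowerSeries E) (n : ℕ) : PowerSeries.coeff n (M * expSeries θ) =
      ∑ k ∈ range (n + 1), (1 / (k.factorial : ℚ)) • PowerSeries.coeff n (M * θ ^ k) := by
  simp only [PowerSeries.coeff_mul, smul_sum]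
  rw [sum_comm]
  refine sum_congr rfl fun x hx => ?_
  rw [HasAntidiagonal.mem_antidiagonal] at hx
  rw [coeff_expSeries h0 (show x.2 ≤ n by omega), mul_sum]
  simp only [mul_smul_comm]

theorem coeff_expSeries_mul {θ : PowerSeries E} (h0 : PowerSeries.coeff 0 θ = 0)
    (M : PowerSeries E) (n : ℕ) : PowerSeries.coeff n (expSeries θ * M) =
      ∑ k ∈ range (n + 1), (1 / (k.factorial : ℚ)) • PowerSeries.coeff n (θ ^ k * M) := by
  simp only [PowerSeries.coeff_mul, smul_sum]
  rw [sum_comm]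
  refine sum_congr rfl fun x hx => ?_
  rw [HasAntidiagonal.mem_antidiagonal] at hx
  rw [coeff_expSeries h0 (show x.1 ≤ n by omega), sum_mul]
  simp only [smul_mul_assoc]

theorem commute_expSeries {θ M : PowerSeries E} (h0 : PowerSeries.coeff 0 θ = 0)
    (h : Commute M θ) : Commute M (expSeries θ) := by
  ext1 n
  rw [coeff_mul_expSeries h0, coeff_expSeries_mul h0]
  exact sum_congr rfl fun k _ => by rw [(h.pow_right k).eq]

theorem euler_expSeries {θ : PowerSeries E} (h0 : PowerSeries.coeff 0 θ = 0)
    (h : Commute (euler E θ) θ) : euler E (expSeries θ) = euler E θ * expSeries θ := by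
  ext1 n
  rw [coeff_euler, coeff_mul_expSeries h0, coeff_expSeries h0 le_rfl, smul_sum,
    sum_range_succ', sum_range_succ]
  -- The index shift in the exponential sum leaves one surplus top term; it starts in degree n + 1,
  -- since neither θ nor its Euler derivative has a constant term.
  have hn : PowerSeries.coeff n (euler E θ * θ ^ n) = 0 := by
    rw [PowerSeries.coeff_mul]
    refine sum_eq_zero fun x hx => ?_
    rw [HasAntidiagonal.mem_antidiagonal] at hx
    by_cases hx1 : x.1 = 0
    · rw [hx1, coeff_euler, zero_smul, zero_mul]
    · rw [coeff_pow_eq_zero h0 (by omega), mul_zero]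
  rw [hn, smul_zero, add_zero, pow_zero, PowerSeries.coeff_one]
  have hz : n • (1 / ((0 : ℕ).factorial : ℚ)) • (if n = 0 then (1 : E) else 0) = 0 := by
    rcases Nat.eq_zero_or_pos n with rfl | hn
    · simp
    · rw [if_neg (by omega), smul_zero, smul_zero]
  rw [hz, add_zero]
  refine sum_congr rfl fun k _ => ?_
  rw [smul_comm, ← coeff_euler, euler_pow h, map_nsmul, ← Nat.cast_smul_eq_nsmul ℚ, smul_smul]
  congr 1
  rw [Nat.factorial_succ]
  push_cast
  field_simp

theorem coeff_zero_expSeries (θ : PowerSeries E) :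
    PowerSeries.coeff 0 (expSeries θ) = 1 := by
  simp [expSeries]

/-- The product has zero Euler derivative and constant term 1. Commutation of θ with its Euler
derivative makes the two logarithmic derivatives cancel. -/
theorem expSeries_mul_expSeries_neg {θ : PowerSeries E} (h0 : PowerSeries.coeff 0 θ = 0)
    (h : Commute (euler E θ) θ) : expSeries θ * expSeries (-θ) = 1 := by
  have h0' : PowerSeries.coeff 0 (-θ) = 0 := by rw [map_neg, h0, neg_zero]
  have h1 := euler_expSeries h0 h
  have h2 := euler_expSeries (θ := -θ) h0' (by rw [map_neg]; exact h.neg_right.neg_left)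
  have h3 : euler E (expSeries θ * expSeries (-θ)) = 0 := by
    rw [euler_mul, h1, h2, map_neg, (commute_expSeries h0 h).eq]
    noncomm_ring
  refine sub_eq_zero.mp (eq_zero_of_eulerD_eq_zero (δ := fun _ => 0) rfl ?_ ?_)
  · rw [map_sub, PowerSeries.coeff_mul]
    simp [coeff_zero_expSeries]
  · have : euler E 1 = 0 := eulerD_one fun l a b => by simp
    rw [map_sub]
    exact (congrArg₂ (· - ·) h3 this).trans (sub_zero 0)

theorem map_expSeries {E' : Type*} [Ring E'] [Algebra ℚ E'] (φ : E →ₐ[ℚ] E') (θ : PowerSeries E)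
    (n : ℕ) : φ (PowerSeries.coeff n (expSeries θ)) =
      PowerSeries.coeff n (expSeries (PowerSeries.map (φ : E →+* E') θ)) := by
  simp only [expSeries, PowerSeries.coeff_mk, map_sum, map_smul, ← map_pow]
  rfl

end Exp

/-! ### The Miwa shift: flow invariance, inverse, Schur polynomials. -/

section Shift

variable {A : Type*} [CommRing A] [Algebra ℚ A] {pd : ℕ+ → Derivation ℚ A A}

theorem coeff_zero_timeSeries {E : Type*} [Ring E] (x : ℕ+ → E) :
    PowerSeries.coeff 0 (timeSeries x) = 0 := by
  simp [timeSeries]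

theorem timeSeries_bracketD_neg (pd : ℕ+ → Derivation ℚ A A) (c : ℚ) :
    timeSeries (bracketD pd (-c)) = -timeSeries (bracketD pd c) := by
  ext1 n
  simp only [timeSeries, map_neg, PowerSeries.coeff_mk]
  split_ifs
  · exact LinearMap.ext fun f => by simp [bracketD, neg_div]
  · simp

/-- The factor n from ε d/dε cancels the weight 1/n in [∂], leaving the bare time derivatives that
occur in `flow`. -/
theorem coeff_euler_timeSeries (c : ℚ) (n : ℕ) :
    PowerSeries.coeff n (euler _ (timeSeries (bracketD pd c))) =
      c • (timeDer pd n : A →ₗ[ℚ] A) := by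
  rw [coeff_euler, timeSeries, PowerSeries.coeff_mk]
  unfold timeDer
  split_ifs with h
  · unfold bracketD
    rw [← Nat.cast_smul_eq_nsmul ℚ, smul_smul]
    congr 1
    have : (n : ℚ) ≠ 0 := by exact_mod_cast h.ne'
    simp only [PNat.mk_coe]
    field_simp
  · simp

theorem commute_euler_timeSeries
    (hpd : ∀ (m n : ℕ+) (f : A), pd m (pd n f) = pd n (pd m f)) (c : ℚ) :
    Commute (euler _ (timeSeries (bracketD pd c))) (timeSeries (bracketD pd c)) := by
  have h : ∀ i j, Commute (PowerSeries.coeff i (timeSeries (bracketD pd c)))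
      (PowerSeries.coeff j (timeSeries (bracketD pd c))) := by
    intro i j
    simp only [timeSeries, PowerSeries.coeff_mk]
    split_ifs
    · exact bracketD_comm hpd c _ ⟨_, rfl⟩ _ ⟨_, rfl⟩
    · exact Commute.zero_right _
    · exact Commute.zero_left _
    · exact Commute.zero_left _
  ext1 n
  rw [PowerSeries.coeff_mul, PowerSeries.coeff_mul, ← Nat.sum_antidiagonal_swap]
  refine sum_congr rfl fun x _ => ?_
  simp only [Prod.fst_swap, Prod.snd_swap, coeff_euler]
  exact ((h x.2 x.1).smul_left _).eq

theorem coeff_zero_miwaShift (c : ℚ) (f : A) :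
    PowerSeries.coeff 0 (miwaShift pd c f) = f := by
  rw [miwaShift, PowerSeries.coeff_mk, coeff_zero_expSeries]
  rfl

/-- For c = -1, ε d/dε applied to the exponential gives -∑ ε^l ∂_l times it, which the second half
of `flow` cancels. -/
theorem flow_miwaShift (hpd : ∀ (m n : ℕ+) (f : A), pd m (pd n f) = pd n (pd m f)) (f : A) :
    flow pd (miwaShift pd (-1) f) = 0 := by
  ext n
  have h := congrArg (fun F : PowerSeries (Module.End ℚ A) => PowerSeries.coeff n F f)
    (euler_expSeries (coeff_zero_timeSeries _) (commute_euler_timeSeries hpd (-1)))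
  simp only [PowerSeries.coeff_mul, coeff_euler_timeSeries, LinearMap.sum_apply,
    Module.End.mul_apply, LinearMap.smul_apply] at h
  rw [coeff_euler, LinearMap.smul_apply] at h
  rw [flow, coeff_eulerD, map_zero]
  simp only [miwaShift, PowerSeries.coeff_mk]
  rw [h, ← sum_add_distrib]
  refine sum_eq_zero fun x _ => ?_
  simp

/-- The coefficientwise action of a series of endomorphisms on a series. -/
noncomputable def act (T : PowerSeries (Module.End ℚ A)) : PowerSeries A →+ PowerSeries A :=
  AddMonoidHom.mk' (fun H => PowerSeries.mk fun n =>
    ∑ x ∈ antidiagonal n, PowerSeries.coeff x.1 T (PowerSeries.coeff x.2 H)) fun F G => by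
    ext n; simp [sum_add_distrib]

theorem coeff_act (T : PowerSeries (Module.End ℚ A)) (H : PowerSeries A) (n : ℕ) :
    PowerSeries.coeff n (act T H) =
      ∑ x ∈ antidiagonal n, PowerSeries.coeff x.1 T (PowerSeries.coeff x.2 H) := by
  simp [act]

theorem act_X_mul (T : PowerSeries (Module.End ℚ A)) (H : PowerSeries A) :
    act T (PowerSeries.X * H) = PowerSeries.X * act T H := by
  ext n
  rcases n with _ | n
  · simp [coeff_act]
  · rw [coeff_act, Nat.sum_antidiagonal_succ', PowerSeries.coeff_zero_X_mul, map_zero]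
    simp [PowerSeries.coeff_succ_X_mul, coeff_act]

theorem act_C (c : ℚ) (f : A) :
    act (expSeries (timeSeries (bracketD pd c))) (PowerSeries.C f) = miwaShift pd c f := by
  ext n
  rw [coeff_act, sum_eq_single (n, 0), miwaShift, PowerSeries.coeff_mk]
  · simp
  · rintro ⟨p, q⟩ hx hne
    rw [HasAntidiagonal.mem_antidiagonal] at hx
    have : q ≠ 0 := by rintro rfl; simp at hx; exact hne (by rw [hx])
    simp [PowerSeries.coeff_C, this]
  · simp

/-- Multiplicativity of the shift, applied to each coefficient of `H`. Together with
`act_miwaShift_neg` it carries the identity for t - [ε] over to t + [ε]. -/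
theorem act_C_mul (c : ℚ) (f : A) (H : PowerSeries A) :
    act (expSeries (timeSeries (bracketD pd c))) (PowerSeries.C f * H) =
      miwaShift pd c f * act (expSeries (timeSeries (bracketD pd c))) H := by
  ext n
  have h : ∀ (m : ℕ) (g : A),
      PowerSeries.coeff m (expSeries (timeSeries (bracketD pd c))) (f * g) =
      ∑ x ∈ antidiagonal m, PowerSeries.coeff x.1 (miwaShift pd c f) *
        PowerSeries.coeff x.2 (expSeries (timeSeries (bracketD pd c))) g := by
    intro m g
    have := congrArg (PowerSeries.coeff m) (miwaShift_mul pd c f g)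
    rw [PowerSeries.coeff_mul, miwaShift, PowerSeries.coeff_mk] at this
    rw [this]
    refine sum_congr rfl fun x _ => ?_
    rw [show PowerSeries.coeff x.2 (miwaShift pd c g) = _ from PowerSeries.coeff_mk _ _]
  rw [coeff_act, PowerSeries.coeff_mul]
  simp only [PowerSeries.coeff_C_mul, h, coeff_act, mul_sum]
  exact sum_antidiagonal_assoc n (fun p q r => PowerSeries.coeff p (miwaShift pd c f) *
    PowerSeries.coeff q (expSeries (timeSeries (bracketD pd c))) (PowerSeries.coeff r H))

theorem act_miwaShift_neg (hpd : ∀ (m n : ℕ+) (f : A), pd m (pd n f) = pd n (pd m f)) (c : ℚ)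
    (f : A) : act (expSeries (timeSeries (bracketD pd c))) (miwaShift pd (-c) f) =
      PowerSeries.C f := by
  ext n
  have h := congrArg (fun F : PowerSeries (Module.End ℚ A) => PowerSeries.coeff n F f)
    (expSeries_mul_expSeries_neg (coeff_zero_timeSeries _) (commute_euler_timeSeries hpd c))
  simp only [PowerSeries.coeff_mul, LinearMap.sum_apply, Module.End.mul_apply,
    PowerSeries.coeff_one] at h
  rw [coeff_act, PowerSeries.coeff_C]
  simp only [miwaShift, PowerSeries.coeff_mk, timeSeries_bracketD_neg]
  rw [h]
  split_ifs <;> rfl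

/-- Evaluation at commuting operators is an algebra homomorphism, so it passes through the
exponential series defining the Schur polynomials and turns it into the one defining the shift. -/
theorem polyD_schurPoly (hpd : ∀ (m n : ℕ+) (f : A), pd m (pd n f) = pd n (pd m f)) (c : ℚ)
    (s : ℕ) (f : A) :
    polyD pd hpd c (schurPoly s) f = PowerSeries.coeff s (miwaShift pd c f) := by
  rw [polyD, schurPoly, map_expSeries, miwaShift, PowerSeries.coeff_mk]
  congr 4
  ext1 n
  rw [PowerSeries.coeff_map, timeSeries, timeSeries, PowerSeries.coeff_mk, PowerSeries.coeff_mk]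
  split_ifs
  · exact evalCommuting_X _ (bracketD_comm hpd c) _
  · exact map_zero _

end Shift

end KP

/-! ### Eigenfunctions, adjoint eigenfunctions and the squared eigenfunction potential. -/

namespace KP

open Finset PDO PDO.Op

variable {A : Type*} [CommRing A] [Algebra ℚ A]

namespace PDO.Op

variable {d : Derivation ℚ A A}

theorem plusApply_plus (P : Op d) (f : A) : plusApply d (plus d P) f = plusApply d P f := by
  unfold plusApply
  refine finsum_congr fun j => ?_
  change (if (0 : ℤ) ≤ j then (if (0 : ℤ) ≤ j then P.coeff j else 0) else 0) * _ =
    (if (0 : ℤ) ≤ j then P.coeff j else 0) * _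
  rw [if_pos (by omega)]

/-- The negative part of P contributes only order at most -2 after multiplication by D⁻¹ f, so it
does not affect the residue. -/
theorem res_D_mul_C_mul_plus (P : Op d) (f : A) :
    res (D d (-1) * C d f * plus d P) = plusApply d (adj d P) f := by
  rw [plusApply_adj_eq_res, ← sub_eq_zero, ← map_sub, ← mul_sub]
  have h : OrdLE (-1) (plus d P - P) := by
    have := (ordLE_sub_plus P).neg
    rwa [neg_sub] at this
  exact res_eq_zero (((ordLE_D (-1)).mul (ordLE_C f)).mul h) (by omega)

theorem res_D_mul_C (f : A) : res (D d (-1) * C d f) = f := by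
  have := coeff_mul_add (ordLE_D (d := d) (-1)) (ordLE_C f)
  rw [add_zero] at this
  rw [res_apply, this, coeff_D, coeff_C]
  simp

theorem res_D_mul_C_mul_D (f : A) : res (D d (-1) * C d f * D d (-1)) = 0 :=
  res_eq_zero (((ordLE_D (-1)).mul (ordLE_C f)).mul (ordLE_D (-1))) (by omega)

theorem coeffwise_res_map_mul (a : PowerSeries A) (F : PowerSeries (Op d)) :
    coeffwise res (PowerSeries.map (C d) a * F) = a * coeffwise res F := by
  ext n
  rw [coeff_coeffwise, PowerSeries.coeff_mul, PowerSeries.coeff_mul, map_sum]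
  simp only [PowerSeries.coeff_map, res_C_mul, coeff_coeffwise]

theorem C_D_mul_map (a : PowerSeries A) :
    PowerSeries.C (D d 1) * PowerSeries.map (C d) a =
      PowerSeries.map (C d) a * PowerSeries.C (D d 1) +
        PowerSeries.map (C d) (coeffwise ((d : A →ₗ[ℚ] A) : A →+ A) a) := by
  ext1 n
  simp only [map_add, PowerSeries.coeff_C_mul, PowerSeries.coeff_mul_C, PowerSeries.coeff_map,
    coeff_coeffwise]
  exact D_mul_C _

/-- The formal adjoint of `1 + c - ε D`, applied to a series of functions. -/
noncomputable def miwaOpAdj (Q : Op d) : PowerSeries A →+ PowerSeries A :=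
  AddMonoidHom.id _ + AddMonoidHom.mulLeft (dressFun Q) +
    (AddMonoidHom.mulLeft PowerSeries.X).comp (coeffwise ((d : A →ₗ[ℚ] A) : A →+ A))

theorem miwaOpAdj_apply (Q : Op d) (η : PowerSeries A) : miwaOpAdj Q η =
    η + dressFun Q * η + PowerSeries.X * coeffwise ((d : A →ₗ[ℚ] A) : A →+ A) η := rfl

/-- By Dη = ηD + η', the operator ηG equals the function G*η minus εDη; multiply by D⁻¹ on the left.
-/
theorem D_mul_map_miwaOpAdj (Q : Op d) (η : PowerSeries A) :
    PowerSeries.C (D d (-1)) * PowerSeries.map (C d) (miwaOpAdj Q η) =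
      PowerSeries.C (D d (-1)) * PowerSeries.map (C d) η * miwaOp Q +
        PowerSeries.X * PowerSeries.map (C d) η := by
  have h1 : PowerSeries.map (C d) η * miwaOp Q = PowerSeries.map (C d) (miwaOpAdj Q η) -
      PowerSeries.X * (PowerSeries.C (D d 1) * PowerSeries.map (C d) η) := by
    rw [C_D_mul_map, miwaOpAdj_apply, miwaOp, map_add, map_add, map_mul, map_mul,
      PowerSeries.map_X, mul_sub, mul_add, mul_one, ← map_mul, ← map_mul, mul_comm η, ← mul_assoc,
      ← PowerSeries.X_mul]
    noncomm_ring
  have h2 : PowerSeries.C (D d (-1)) * PowerSeries.C (D d 1) = 1 := by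
    rw [← map_mul, D_mul_D]
    exact map_one _
  rw [mul_assoc, h1, mul_sub, ← mul_assoc _ PowerSeries.X, ← PowerSeries.X_mul, mul_assoc,
    ← mul_assoc _ (PowerSeries.C (D d 1)), h2, one_mul, sub_add_cancel]

theorem D_mul_map_miwaOpAdj_mul_geomPlus {Q : Op d} (hQ : OrdLE 1 Q) (h1 : Q.coeff 1 = 1)
    (η : PowerSeries A) :
    PowerSeries.C (D d (-1)) * PowerSeries.map (C d) (miwaOpAdj Q η) * geomPlus Q =
      PowerSeries.C (D d (-1)) *
        PowerSeries.map (C d) (η * (1 + PowerSeries.X * geomRes Q)) +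
        PowerSeries.X * (PowerSeries.map (C d) η * geomPlus Q) := by
  rw [D_mul_map_miwaOpAdj, add_mul, mul_assoc _ (miwaOp Q), miwaOp_mul_geomPlus hQ h1, map_mul,
    map_add, map_one, map_mul, PowerSeries.map_X, mul_assoc, mul_assoc]

theorem coeffwise_res_D_mul_map (a : PowerSeries A) :
    coeffwise res (PowerSeries.C (D d (-1)) * PowerSeries.map (C d) a) = a := by
  ext n
  rw [coeff_coeffwise, PowerSeries.coeff_C_mul, PowerSeries.coeff_map, res_D_mul_C]

theorem coeffwise_res_geomPlus (Q : Op d) : coeffwise res (geomPlus Q) = 0 := by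
  ext n
  rw [coeff_coeffwise, (sDifferential_geomPlus Q n).res_eq_zero, map_zero]

theorem coeffwise_res_miwaOpAdj {Q : Op d} (hQ : OrdLE 1 Q) (h1 : Q.coeff 1 = 1)
    (η : PowerSeries A) :
    coeffwise res (PowerSeries.C (D d (-1)) * PowerSeries.map (C d) (miwaOpAdj Q η) *
      geomPlus Q) = η * (1 + PowerSeries.X * geomRes Q) := by
  rw [D_mul_map_miwaOpAdj_mul_geomPlus hQ h1, map_add, coeffwise_res_D_mul_map, coeffwise_X_mul,
    coeffwise_res_map_mul, coeffwise_res_geomPlus, mul_zero, mul_zero, add_zero]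

theorem plus_one : plus d 1 = 1 := Op.ext fun k => by
  rw [coeff_plus, ← D_zero, coeff_D]
  split_ifs <;> first | rfl | omega

theorem map_C_C (a : A) : PowerSeries.map (C d) (PowerSeries.C a) = PowerSeries.C (C d a) :=
  PowerSeries.map_C _ _

end PDO.Op

variable {pd : ℕ+ → Derivation ℚ A A} {Q : Op (pd 1)}

/-- The residue carries all the equations for Ψ, with a minus sign. Its n = 0 term is Ψ itself,
since (Q⁰)_+ = 1, and the separate summand Ψ compensates for it. -/
theorem flow_C_adjoint_eigenfunction {Ψ : A}
    (hΨ : ∀ n : ℕ+, pd n Ψ = -plusApply (pd 1) (adj (pd 1) (Q ^ (n : ℕ))) Ψ) :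
    flow pd (PowerSeries.C Ψ) = PowerSeries.C Ψ - coeffwise res
      (PowerSeries.C (D (pd 1) (-1)) * PowerSeries.map (C (pd 1)) (PowerSeries.C Ψ) *
        geomPlus Q) := by
  ext n
  rw [coeff_flow_C, map_sub, coeff_coeffwise, map_C_C, ← map_mul, PowerSeries.coeff_C_mul,
    coeff_geomPlus]
  rcases Nat.eq_zero_or_pos n with rfl | hn
  · rw [pow_zero, plus_one, mul_one, res_D_mul_C, timeDer_zero]
    simp
  · obtain ⟨n, rfl⟩ : ∃ m : ℕ+, (m : ℕ) = n := ⟨⟨n, hn⟩, rfl⟩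
    rw [timeDer_pos, hΨ, res_D_mul_C_mul_plus, PowerSeries.coeff_C, if_neg (by omega), zero_sub]

/-- The Miwa shift of an adjoint eigenfunction solves a first order differential equation. -/
theorem miwaOpAdj_miwaShift (hpd : ∀ (m n : ℕ+) (f : A), pd m (pd n f) = pd n (pd m f))
    (hQ : OrdLE 1 Q) (h1 : Q.coeff 1 = 1)
    (hLax : ∀ n : ℕ+, der (pd n) Q = plus _ (Q ^ (n : ℕ)) * Q - Q * plus _ (Q ^ (n : ℕ)))
    {Ψ : A} (hΨ : ∀ n : ℕ+, pd n Ψ = -plusApply (pd 1) (adj (pd 1) (Q ^ (n : ℕ))) Ψ) :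
    miwaOpAdj Q (miwaShift pd (-1) Ψ) = PowerSeries.C Ψ := by
  set η := miwaShift pd (-1) Ψ with hη
  set T : PowerSeries A → PowerSeries A := fun Z => coeffwise res
    (PowerSeries.C (D (pd 1) (-1)) * PowerSeries.map (C (pd 1)) Z * geomPlus Q) with hT
  have hTsub : ∀ Z Z', T (Z - Z') = T Z - T Z' := by
    intro Z Z'; simp only [hT, map_sub, mul_sub, sub_mul]
  set Z := miwaOpAdj Q η - PowerSeries.C Ψ with hZ
  have hTη : T (miwaOpAdj Q η) = η * (1 + PowerSeries.X * geomRes Q) :=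
    coeffwise_res_miwaOpAdj hQ h1 η
  -- Because the flow kills η, the flow of G*η is (c - ερ)η + εη' = G*η - η(1 + ερ), and the last
  -- term is T(G*η). Thus G*η obeys the same linear equation as Ψ.
  have hflow : flow pd Z = Z - T Z := by
    have hη0 : flow pd η = 0 := flow_miwaShift hpd Ψ
    rw [hZ, hTsub, hTη, map_sub, flow_C_adjoint_eigenfunction hΨ, miwaOpAdj_apply, map_add,
      map_add, flow_mul, flow_X_mul, flow_coeffwise hpd, hη0,
      flow_dressFun hpd hQ h1 hLax, map_zero]
    simp only [hT]
    ring
  refine sub_eq_zero.mp ?_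
  change Z = 0
  ext n
  rw [map_zero]
  induction n using Nat.strong_induction_on with
  | _ n ih =>
    rcases Nat.eq_zero_or_pos n with rfl | hn
    · rw [hZ, miwaOpAdj_apply]
      have h0 : PowerSeries.coeff 0 (dressFun Q) = 0 := PowerSeries.coeff_mk _ _
      rw [map_sub, map_add, map_add, PowerSeries.coeff_zero_X_mul, hη, coeff_zero_miwaShift,
        PowerSeries.coeff_mul, PowerSeries.coeff_C, if_pos rfl, Nat.antidiagonal_zero,
        sum_singleton, h0, zero_mul, add_zero, add_zero, sub_self]
    · have e1 : PowerSeries.coeff n (flow pd Z) = n • PowerSeries.coeff n Z :=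
        coeff_eulerD_of_forall_lt (by ext a; simp [timeDer_zero]) ih
      -- When the lower coefficients of Z vanish, only the n = 0 term of B, namely 1, contributes.
      -- The equation then reads n Z_n = Z_n - Z_n = 0.
      have e2 : PowerSeries.coeff n (T Z) = PowerSeries.coeff n Z := by
        simp only [hT]
        rw [coeff_coeffwise, PowerSeries.coeff_mul, sum_eq_single (n, 0)]
        · rw [PowerSeries.coeff_C_mul, PowerSeries.coeff_map, coeff_geomPlus, pow_zero, plus_one,
            mul_one, res_D_mul_C]
        · rintro ⟨p, q⟩ hx hne
          rw [HasAntidiagonal.mem_antidiagonal] at hx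
          have : q ≠ 0 := by rintro rfl; simp at hx; exact hne (by rw [hx])
          rw [PowerSeries.coeff_C_mul, PowerSeries.coeff_map, ih p (by simp at hx; omega),
            map_zero, mul_zero, zero_mul]
        · simp
      rw [hflow, map_sub, e2, sub_self] at e1
      exact eq_zero_of_nsmul_eq_zero (by omega) e1.symm

theorem flow_C_eigenfunction {Φ : A}
    (hΦ : ∀ n : ℕ+, pd n Φ = plusApply (pd 1) (Q ^ (n : ℕ)) Φ) :
    coeffwise res (geomPlus Q * PowerSeries.C (C (pd 1) Φ) * PowerSeries.C (D (pd 1) (-1))) =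
      PowerSeries.C Φ + flow pd (PowerSeries.C Φ) := by
  ext n
  rw [coeff_coeffwise, PowerSeries.coeff_mul_C, PowerSeries.coeff_mul_C, coeff_geomPlus, map_add,
    coeff_flow_C, ← plusApply_eq_res, plusApply_plus]
  rcases Nat.eq_zero_or_pos n with rfl | hn
  · rw [pow_zero, plusApply_eq_res, one_mul, timeDer_zero, res_apply, Op.coeff_mul_D, coeff_C]
    simp
  · obtain ⟨n, rfl⟩ : ∃ m : ℕ+, (m : ℕ) = n := ⟨⟨n, hn⟩, rfl⟩
    rw [timeDer_pos, hΦ, PowerSeries.coeff_C, if_neg (by omega), zero_add]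

/-- Replacing Ψ by G*η turns D⁻¹ΨB into D⁻¹η(1 + ερ) + εηB. The first summand, multiplied by ΦD⁻¹,
has order at most -2 and no residue; the second gives εη Res(BΦD⁻¹), which is known from the
eigenfunction equations. -/
theorem flow_C_potential {Φ Ψ S : A} {η : PowerSeries A}
    (hQ : OrdLE 1 Q) (h1 : Q.coeff 1 = 1)
    (hη : miwaOpAdj Q η = PowerSeries.C Ψ)
    (hΦ : ∀ n : ℕ+, pd n Φ = plusApply (pd 1) (Q ^ (n : ℕ)) Φ)
    (hS : ∀ n : ℕ+, pd n S = Op.res (D (pd 1) (-1) * C (pd 1) Ψ * plus (pd 1) (Q ^ (n : ℕ)) *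
      C (pd 1) Φ * D (pd 1) (-1))) :
    flow pd (PowerSeries.C S) =
      PowerSeries.X * (η * (PowerSeries.C Φ + flow pd (PowerSeries.C Φ))) := by
  have e1 : flow pd (PowerSeries.C S) = coeffwise res
      (PowerSeries.C (D (pd 1) (-1)) * PowerSeries.map (C (pd 1)) (PowerSeries.C Ψ) * geomPlus Q *
        PowerSeries.C (C (pd 1) Φ) * PowerSeries.C (D (pd 1) (-1))) := by
    ext n
    rw [coeff_flow_C, coeff_coeffwise, PowerSeries.coeff_mul_C, PowerSeries.coeff_mul_C, map_C_C,
      ← map_mul, PowerSeries.coeff_C_mul, coeff_geomPlus]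
    rcases Nat.eq_zero_or_pos n with rfl | hn
    · rw [pow_zero, plus_one, mul_one, mul_assoc (D (pd 1) (-1)), ← map_mul, res_D_mul_C_mul_D,
        timeDer_zero]
      rfl
    · obtain ⟨n, rfl⟩ : ∃ m : ℕ+, (m : ℕ) = n := ⟨⟨n, hn⟩, rfl⟩
      rw [timeDer_pos, hS]
  rw [e1, ← hη, D_mul_map_miwaOpAdj_mul_geomPlus hQ h1, add_mul, add_mul, map_add]
  have e2 : coeffwise res (PowerSeries.C (D (pd 1) (-1)) *
      PowerSeries.map (C (pd 1)) (η * (1 + PowerSeries.X * geomRes Q)) *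
        PowerSeries.C (C (pd 1) Φ) * PowerSeries.C (D (pd 1) (-1))) = 0 := by
    ext n
    rw [coeff_coeffwise, PowerSeries.coeff_mul_C, PowerSeries.coeff_mul_C,
      PowerSeries.coeff_C_mul, PowerSeries.coeff_map, mul_assoc (D (pd 1) (-1)), ← map_mul,
      res_D_mul_C_mul_D, map_zero]
  rw [e2, zero_add, mul_assoc PowerSeries.X, mul_assoc PowerSeries.X, coeffwise_X_mul,
    mul_assoc, mul_assoc, coeffwise_res_map_mul, ← mul_assoc (geomPlus Q),
    flow_C_eigenfunction hΦ]

end KP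

/-! ### The identities for S. -/

theorem mainTheorem5 {A : Type*} [CommRing A] [Algebra ℚ A]
    (pd : ℕ+ → Derivation ℚ A A)
    (hpd : ∀ (m n : ℕ+) (f : A), pd m (pd n f) = pd n (pd m f))
    (r : ℕ) (hr : 1 ≤ r) (L Q : KP.PDO A)
    (hL : KP.PDO.IsLaxForm r L) (hQ : KP.PDO.IsRoot (pd 1) r L Q)
    (hLax : KP.LaxEquations pd L Q)
    (Φ Ψ S : A)
    (hΦ : KP.IsEigenfunction pd Q Φ) (hΨ : KP.IsAdjointEigenfunction pd Q Ψ)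
    (hS : KP.IsSEP pd Q Φ Ψ S) :
    (KP.miwaShift pd (-1) S - PowerSeries.C S =
        -(PowerSeries.X * PowerSeries.C Φ * KP.miwaShift pd (-1) Ψ)) ∧
    (KP.miwaShift pd 1 S - PowerSeries.C S =
        PowerSeries.X * KP.miwaShift pd 1 Φ * PowerSeries.C Ψ) ∧
    (∀ s : ℕ, 1 ≤ s →
      KP.polyD pd hpd (-1) (KP.schurPoly s) S =
        -(Φ * KP.polyD pd hpd (-1) (KP.schurPoly (s - 1)) Ψ)) ∧
    (∀ s : ℕ, 1 ≤ s →
      KP.polyD pd hpd 1 (KP.schurPoly s) S =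
        Ψ * KP.polyD pd hpd 1 (KP.schurPoly (s - 1)) Φ) := by
  obtain ⟨hQ1, hQ0, hQr⟩ := hQ
  let q : KP.PDO.Op (pd 1) := Q
  have hq : KP.PDO.Op.OrdLE 1 q := hQ0
  have hq1 : q.coeff 1 = 1 := hQ1
  have hpow : ∀ n : ℕ, KP.PDO.pow (pd 1) Q n = q ^ n := fun n => (KP.PDO.Op.pow_eq q n).symm
  have hLax' : ∀ n : ℕ+, KP.PDO.Op.der (pd n) q =
      KP.PDO.Op.plus _ (q ^ (n : ℕ)) * q - q * KP.PDO.Op.plus _ (q ^ (n : ℕ)) := by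
    intro n
    refine KP.PDO.Op.der_eq_commutator_of_pow (hpd n 1) hq hq1 hr _ (KP.PDO.Op.ext fun k => ?_)
    have h := hLax n k
    rw [← hQr, hpow, hpow] at h
    exact h.trans (KP.PDO.Op.coeff_sub _ _ k).symm
  have hΦ' : ∀ n : ℕ+, pd n Φ = KP.PDO.plusApply (pd 1) (q ^ (n : ℕ)) Φ := by
    intro n; rw [hΦ n, hpow]
  have hΨ' : ∀ n : ℕ+, pd n Ψ =
      -KP.PDO.plusApply (pd 1) (KP.PDO.Op.adj (pd 1) (q ^ (n : ℕ))) Ψ := by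
    intro n
    -- The hypothesis uses powers of Q*, the residue calculus the adjoint of Q^n; they agree because
    -- the adjoint is an anti-homomorphism.
    rw [hΨ n, KP.PDO.Op.adj_pow, KP.PDO.Op.pow_eq]
    rfl
  have hS' : ∀ n : ℕ+, pd n S = KP.PDO.Op.res (KP.PDO.Op.D (pd 1) (-1) * KP.PDO.Op.C (pd 1) Ψ *
      KP.PDO.Op.plus (pd 1) (q ^ (n : ℕ)) * KP.PDO.Op.C (pd 1) Φ * KP.PDO.Op.D (pd 1) (-1)) := by
    intro n
    rw [hS n, hpow]
    rfl
  have hη := KP.miwaOpAdj_miwaShift hpd hq hq1 hLax' hΨ'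
  have hNS := KP.flow_C_potential hq hq1 hη hΦ' hS'
  have minus : KP.miwaShift pd (-1) S - PowerSeries.C S =
      -(PowerSeries.X * PowerSeries.C Φ * KP.miwaShift pd (-1) Ψ) := by
    have : KP.miwaShift pd (-1) S - PowerSeries.C S +
        PowerSeries.X * (PowerSeries.C Φ * KP.miwaShift pd (-1) Ψ) = 0 := by
      -- Both shifts are killed by the flow, so what remains is -N S + εη(Φ + N Φ), which vanishes
      -- by `hNS`.
      refine KP.eq_zero_of_flow_eq_zero (pd := pd) ?_ ?_
      · rw [map_add, map_sub, KP.coeff_zero_miwaShift, PowerSeries.coeff_zero_X_mul,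
          PowerSeries.coeff_C, if_pos rfl, sub_self, add_zero]
      · rw [map_add, map_sub, KP.flow_X_mul, KP.flow_mul, KP.flow_miwaShift hpd,
          KP.flow_miwaShift hpd, hNS]
        ring
    linear_combination this
  have plus : KP.miwaShift pd 1 S - PowerSeries.C S =
      PowerSeries.X * KP.miwaShift pd 1 Φ * PowerSeries.C Ψ := by
    -- The shift by +[ε] undoes the shifts by -[ε] and sends the unshifted S and Φ to their forward
    -- shifts; an overall sign gives the claim.
    have h := congrArg
      (KP.act (KP.expSeries (KP.timeSeries (KP.bracketD pd 1)))) minus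
    rw [map_sub, map_neg, KP.act_miwaShift_neg hpd, KP.act_C, mul_assoc, KP.act_X_mul,
      KP.act_C_mul, KP.act_miwaShift_neg hpd] at h
    linear_combination -h
  refine ⟨minus, plus, fun s hs => ?_, fun s hs => ?_⟩
  · obtain ⟨s, rfl⟩ := Nat.exists_eq_add_of_le' hs
    have h := congrArg (PowerSeries.coeff (s + 1)) minus
    rw [map_sub, PowerSeries.coeff_C, if_neg (by omega), sub_zero, map_neg, mul_assoc,
      PowerSeries.coeff_succ_X_mul, PowerSeries.coeff_C_mul] at h
    rw [KP.polyD_schurPoly, KP.polyD_schurPoly, h, Nat.add_sub_cancel]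
  · obtain ⟨s, rfl⟩ := Nat.exists_eq_add_of_le' hs
    have h := congrArg (PowerSeries.coeff (s + 1)) plus
    rw [map_sub, PowerSeries.coeff_C, if_neg (by omega), sub_zero, mul_assoc,
      PowerSeries.coeff_succ_X_mul, PowerSeries.coeff_mul_C] at h
    rw [KP.polyD_schurPoly, KP.polyD_schurPoly, h, Nat.add_sub_cancel, mul_comm]
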